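/- Let $n \ge 0$ be an integer and let $k$ be a field of characteristic $0$. A face is a set composition of $[n]=\{1,\dots,n\}$, i.e. an ordered tuple $F=(F_1,\dots,F_m)$ of nonempty pairwise disjoint sets with union $[n]$; its length is $\ell(F)=m$ and its type is the composition $(|F_1|,\dots,|F_m|)$ of $n$. Let $\mathcal F$ be the finite monoid of all faces, where the product $FG$ of $F=(F_1,\dots,F_m)$ and $G=(G_1,\dots,G_p)$ is the list of all intersections $F_i\cap G_j$, in lexicographic order of $(i,j)$, with the empty sets removed. Let $k\mathcal F$ be its monoid algebra (the face algebra). For a composition $\alpha$ of $n$, put $\widetilde B_\alpha=\sum_{F\in\mathcal F,\ \operatorname{type}F=\alpha}F\in k\mathcal F$. For a permutation $w\in S_n$ let $\operatorname{Des} w=\{i\in[n-1] : w(i)>w(i+1)\}$, and let $B_\alpha=\sum_{w} w\in k[S_n]$, the sum over all $w\in S_n$ with $\operatorname{Des}w\subseteq\{\alpha_1+\dots+\alpha_i : 1\le i<\ell(\alpha)\}$, where $\ell(\alpha)$ is the number of parts of $\alpha$. The elements $B_\alpha$ (for $\alpha$ ranging over all compositions of $n$) form a basis of the descent algebra, which contains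 the permutation $w_0\colon i\mapsto n+1-i$. Let $\rho$ be the $k$-linear map from the descent algebra to $k\mathcal F$ with $\rho(B_\alpha)=\widetilde B_\alpha$ for all $\alpha$, and let $\widetilde w_0=\rho(w_0)$. A face $F$ is contained in a face $G$ if every block of $F$ is a subset of a block of $G$. Let $n_\alpha(F)$ be the number of faces $G$ of type $\alpha$ such that $F$ is contained in $G$, and let $\widetilde n_\alpha(F)=(-1)^{n-\ell(F)}\,n_\alpha(F)$ (the signed knapsack number of $F$). **Theorem.** For every composition $\alpha$ of $n$, the $k$-linear operator $k\mathcal F\to k\mathcal F$, $x\mapsto x\,\widetilde w_0\widetilde B_\alpha$, is diagonalizable. Its eigenvalues are exactly the signed knapsack numbers $\widetilde n_\alpha(F)$ for $F\in\mathcal F$, and the algebraic multiplicity of each eigenvalue $\lambda$ is the number of faces $F\in\mathcal F$ with $\widetilde n_\alpha(F)=\lambda$. -/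

import Mathlib

/-! ## Set compositions (faces) and the face monoid

The set `{1, …, n}` is modelled by `Fin n`. -/

/-- A set composition (face) of `Fin n`: an ordered list of nonempty, pairwise disjoint subsets
whose union is everything. -/
@[ext]
structure SetComposition (n : ℕ) where
  /-- the list of blocks, in order -/
  blocks : List (Finset (Fin n))
  nonempty_of_mem : ∀ A ∈ blocks, A.Nonempty
  pairwise_disjoint : blocks.Pairwise Disjoint
  exists_mem : ∀ x : Fin n, ∃ A ∈ blocks, x ∈ A

namespace SetComposition

variable {n : ℕ}

/-- The reduction of a list of sets: remove all empty sets. -/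
def red (l : List (Finset (Fin n))) : List (Finset (Fin n)) :=
  l.filter (fun A => A.Nonempty)

/-- The list of all intersections `A ∩ B` with `A` in `l` and `B` in `m`, in lexicographic
order of the positions of `A` and `B`. -/
def inters (l m : List (Finset (Fin n))) : List (Finset (Fin n)) :=
  l.flatMap (fun A => m.map (fun B => A ∩ B))

theorem mem_red {l : List (Finset (Fin n))} {A : Finset (Fin n)} :
    A ∈ red l ↔ A ∈ l ∧ A.Nonempty := by
  simp [red]

theorem mem_inters {l m : List (Finset (Fin n))} {C : Finset (Fin n)} :
    C ∈ inters l m ↔ ∃ A ∈ l, ∃ B ∈ m, A ∩ B = C := by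
  simp [inters]

theorem red_append (l m : List (Finset (Fin n))) : red (l ++ m) = red l ++ red m := by
  simp [red]

theorem inters_assoc (a b c : List (Finset (Fin n))) :
    inters (inters a b) c = inters a (inters b c) := by
  simp only [inters, List.flatMap_assoc, List.map_flatMap, List.flatMap_map, List.map_map]
  congr 1
  funext A
  congr 1
  funext B
  congr 1
  funext C
  simp [Finset.inter_assoc]

theorem red_map_red (A : Finset (Fin n)) (m : List (Finset (Fin n))) :
    red ((red m).map (fun B => A ∩ B)) = red (m.map (fun B => A ∩ B)) := by
  induction m with
  | nil => rfl
  | cons B m ih =>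
    by_cases hB : B.Nonempty
    · simp only [red, List.map_cons, List.filter_cons, hB, decide_true, if_true] at ih ⊢
      rw [ih]
    · have h : ¬ (A ∩ B).Nonempty := fun h => hB (h.mono Finset.inter_subset_right)
      simp only [red, List.map_cons, List.filter_cons, hB, h, decide_false] at ih ⊢
      simpa using ih

theorem red_inters_red_right (l m : List (Finset (Fin n))) :
    red (inters l (red m)) = red (inters l m) := by
  induction l with
  | nil => rfl
  | cons A l ih =>
    simp only [inters, List.flatMap_cons, red_append] at ih ⊢
    rw [ih, red_map_red]

theorem red_inters_red_left (l m : List (Finset (Fin n))) :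
    red (inters (red l) m) = red (inters l m) := by
  induction l with
  | nil => rfl
  | cons A l ih =>
    by_cases hA : A.Nonempty
    · have : red (A :: l) = A :: red l := by simp [red, hA]
      rw [this]
      simp only [inters, List.flatMap_cons, red_append] at ih ⊢
      rw [ih]
    · have h1 : red (A :: l) = red l := by simp [red, hA]
      have h2 : red (m.map (fun B => A ∩ B)) = [] := by
        have : A = ∅ := Finset.not_nonempty_iff_eq_empty.mp hA
        subst this
        simp [red]
      rw [h1, ih]
      simp only [inters, List.flatMap_cons, red_append, h2, List.nil_append]

theorem red_blocks (F : SetComposition n) : red F.blocks = F.blocks := by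
  simp only [red, List.filter_eq_self]
  intro A hA
  simpa using F.nonempty_of_mem A hA

/-- The product of two faces: all pairwise intersections of their blocks in lexicographic order,
with the empty intersections thrown away. -/
instance : Mul (SetComposition n) where
  mul F G :=
    { blocks := red (inters F.blocks G.blocks)
      nonempty_of_mem := fun A hA => (mem_red.mp hA).2
      pairwise_disjoint := by
        refine List.Pairwise.filter _ ?_
        rw [inters, List.pairwise_flatMap]
        constructor
        · intro A _
          rw [List.pairwise_map]
          exact G.pairwise_disjoint.imp fun h =>
            h.mono Finset.inter_subset_right Finset.inter_subset_right
        · refine F.pairwise_disjoint.imp fun h => ?_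
          intro x hx y hy
          obtain ⟨B, _, rfl⟩ := List.mem_map.mp hx
          obtain ⟨C, _, rfl⟩ := List.mem_map.mp hy
          exact h.mono Finset.inter_subset_left Finset.inter_subset_left
      exists_mem := fun x => by
        obtain ⟨A, hA, hxA⟩ := F.exists_mem x
        obtain ⟨B, hB, hxB⟩ := G.exists_mem x
        have hx : x ∈ A ∩ B := Finset.mem_inter.mpr ⟨hxA, hxB⟩
        exact ⟨A ∩ B, mem_red.mpr ⟨mem_inters.mpr ⟨A, hA, B, hB, rfl⟩, ⟨x, hx⟩⟩, hx⟩ }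

/-- The face with the single block `Fin n` (with no block at all if `n = 0`). -/
instance : One (SetComposition n) where
  one :=
    { blocks := red [Finset.univ]
      nonempty_of_mem := fun A hA => (mem_red.mp hA).2
      pairwise_disjoint := List.Pairwise.filter _ (List.pairwise_singleton _ _)
      exists_mem := fun x =>
        ⟨Finset.univ, mem_red.mpr ⟨by simp, ⟨x, Finset.mem_univ x⟩⟩, Finset.mem_univ x⟩ }

theorem mul_blocks (F G : SetComposition n) :
    (F * G).blocks = red (inters F.blocks G.blocks) := rfl

theorem one_blocks : (1 : SetComposition n).blocks = red [Finset.univ] := rfl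

/-- The face monoid. -/
instance : Monoid (SetComposition n) where
  mul_assoc E F G := by
    apply SetComposition.ext
    simp only [mul_blocks, red_inters_red_left, red_inters_red_right, inters_assoc]
  one_mul F := by
    apply SetComposition.ext
    rw [mul_blocks, one_blocks, red_inters_red_left]
    simp [inters, red_blocks]
  mul_one F := by
    apply SetComposition.ext
    rw [mul_blocks, one_blocks, red_inters_red_right]
    simp [inters, red_blocks]

theorem blocks_nodup (F : SetComposition n) : F.blocks.Nodup := by
  refine (List.Pairwise.imp_of_mem ?_ F.pairwise_disjoint)
  intro A B hA _ h hAB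
  subst hAB
  exact (F.nonempty_of_mem A hA).ne_empty (disjoint_self.mp h)

noncomputable instance : Fintype (SetComposition n) :=
  Fintype.ofInjective
    (fun F : SetComposition n =>
      (⟨F.blocks, F.blocks_nodup⟩ : {l : List (Finset (Fin n)) // l.Nodup}))
    (fun _ _ h => SetComposition.ext (congrArg Subtype.val h))

theorem sum_card_of_pairwise_disjoint (l : List (Finset (Fin n))) (h : l.Pairwise Disjoint) :
    (l.map Finset.card).sum = (Finset.univ.filter fun x => ∃ A ∈ l, x ∈ A).card := by
  induction l with
  | nil => simp
  | cons A l ih =>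
    rw [List.pairwise_cons] at h
    have hd : Disjoint A (Finset.univ.filter fun x => ∃ B ∈ l, x ∈ B) := by
      rw [Finset.disjoint_left]
      intro x hx hx'
      obtain ⟨B, hB, hxB⟩ := (Finset.mem_filter.mp hx').2
      exact Finset.disjoint_left.mp (h.1 B hB) hx hxB
    rw [List.map_cons, List.sum_cons, ih h.2, ← Finset.card_union_of_disjoint hd]
    congr 1
    ext x
    simp

/-- The type of a face: the composition of `n` formed by the sizes of its blocks. -/
def type (F : SetComposition n) : Composition n where
  blocks := F.blocks.map Finset.card
  blocks_pos := by
    intro i hi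
    obtain ⟨A, hA, rfl⟩ := List.mem_map.mp hi
    exact (F.nonempty_of_mem A hA).card_pos
  blocks_sum := by
    rw [sum_card_of_pairwise_disjoint _ F.pairwise_disjoint,
      Finset.filter_true_of_mem fun x _ => F.exists_mem x, Finset.card_univ, Fintype.card_fin]

/-- The number of blocks of a face. -/
def length (F : SetComposition n) : ℕ := F.blocks.length

/-- In particular, the subtraction `n - F.length` of natural numbers is never truncated. -/
theorem length_le (F : SetComposition n) : F.length ≤ n := by
  simpa [type, length, Composition.length] using F.type.length_le

/-- `F` is contained in `G` if every block of `F` is a subset of a block of `G`. -/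
def ContainedIn (F G : SetComposition n) : Prop :=
  ∀ A ∈ F.blocks, ∃ B ∈ G.blocks, A ⊆ B

open Classical in
/-- The knapsack number of `F` with respect to `α`: the number of faces `G` of type `α`
that contain `F`. -/
noncomputable def knapsack (α : Composition n) (F : SetComposition n) : ℕ :=
  (Finset.univ.filter fun G : SetComposition n => F.ContainedIn G ∧ G.type = α).card

/-- The signed knapsack number of `F` with respect to `α`. -/
noncomputable def signedKnapsack (α : Composition n) (F : SetComposition n) : ℤ :=
  (-1) ^ (n - F.length) * (F.knapsack α : ℤ)

end SetComposition

/-- The face algebra: the monoid algebra of the face monoid. -/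
abbrev FaceAlgebra (k : Type*) [CommRing k] (n : ℕ) := MonoidAlgebra k (SetComposition n)

/-- The sum of all faces of type `α` in the face algebra. -/
noncomputable def faceB (k : Type*) [CommRing k] {n : ℕ} (α : Composition n) : FaceAlgebra k n :=
  ∑ F : SetComposition n with F.type = α, MonoidAlgebra.single F 1

/-! ## The descent algebra -/

/-- The bijection from subsets of `{1, …, n - 1}` to compositions of `n` that lists the distances
between adjacent elements of `J ∪ {0, n}`. The element `j` of `{1, …, n - 1}` is represented by
`j - 1 : Fin (n - 1)`. -/
def gaps (n : ℕ) : Finset (Fin (n - 1)) ≃ Composition n :=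
  (compositionAsSetEquiv n).symm.trans (compositionEquiv n).symm

namespace DescentAlgebra

variable {n : ℕ}

/-- The descent set of `w`. The element `i : Fin (n - 1)` represents the position `i + 1` of
`{1, …, n - 1}`, so the two values compared here are those at the consecutive positions
`i + 1` and `i + 2` of `{1, …, n}`. -/
def des (w : Equiv.Perm (Fin n)) : Finset (Fin (n - 1)) :=
  Finset.univ.filter fun i =>
    w ⟨(i : ℕ) + 1, by have := i.isLt; omega⟩ < w ⟨(i : ℕ), by have := i.isLt; omega⟩

theorem exists_des_eq (J : Finset (Fin (n - 1))) : ∃ w : Equiv.Perm (Fin n), des w = J := by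
  let c : Fin n → ℤ := fun i => ((J.filter fun j : Fin (n - 1) => (j : ℕ) < (i : ℕ)).card : ℤ)
  let f : Fin n → ℤ := fun i => (i : ℤ) - n * c i
  have hstep : ∀ i : Fin (n - 1), ∀ (h0 : (i : ℕ) < n) (h1 : (i : ℕ) + 1 < n),
      c ⟨(i : ℕ) + 1, h1⟩ = c ⟨(i : ℕ), h0⟩ + if i ∈ J then 1 else 0 := by
    intro i h0 h1
    simp only [c]
    split_ifs with hi
    · have : (J.filter fun j : Fin (n - 1) => (j : ℕ) < (i : ℕ) + 1)
          = insert i (J.filter fun j : Fin (n - 1) => (j : ℕ) < (i : ℕ)) := by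
        ext j
        simp only [Finset.mem_filter, Finset.mem_insert, Fin.ext_iff]
        constructor
        · rintro ⟨hj, hlt⟩
          by_cases h : (j : ℕ) = i
          · exact Or.inl h
          · exact Or.inr ⟨hj, by omega⟩
        · rintro (h | ⟨hj, hlt⟩)
          · have : j = i := Fin.ext h
            subst this
            exact ⟨hi, by omega⟩
          · exact ⟨hj, by omega⟩
      rw [this, Finset.card_insert_of_notMem (by simp)]
      push_cast
      ring
    · have : (J.filter fun j : Fin (n - 1) => (j : ℕ) < (i : ℕ) + 1)
          = (J.filter fun j : Fin (n - 1) => (j : ℕ) < (i : ℕ)) := by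
        ext j
        simp only [Finset.mem_filter]
        constructor
        · rintro ⟨hj, hlt⟩
          refine ⟨hj, ?_⟩
          by_contra h
          have : j = i := Fin.ext (by omega)
          exact hi (this ▸ hj)
        · rintro ⟨hj, hlt⟩
          exact ⟨hj, by omega⟩
      rw [this]
      simp
  have hinj : Function.Injective f := by
    intro a b hab
    simp only [f] at hab
    have ha := a.isLt
    have hb := b.isLt
    have hn : (0 : ℤ) < n := by omega
    have h1 : ((a : ℤ) - b) = n * (c a - c b) := by linarith
    have h2 : c a - c b = 0 := by
      by_contra hne
      rcases lt_or_gt_of_ne hne with h | h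
      · have : (n : ℤ) * (c a - c b) ≤ n * (-1) :=
          mul_le_mul_of_nonneg_left (by omega) hn.le
        omega
      · have : (n : ℤ) * 1 ≤ n * (c a - c b) :=
          mul_le_mul_of_nonneg_left (by omega) hn.le
        omega
    rw [h2, mul_zero] at h1
    exact Fin.ext (by omega)
  have hmono : StrictMono (f ∘ Tuple.sort f) :=
    (Tuple.monotone_sort f).strictMono_of_injective (hinj.comp (Tuple.sort f).injective)
  refine ⟨(Tuple.sort f).symm, ?_⟩
  ext i
  have h0 : (i : ℕ) < n := by have := i.isLt; omega
  have h1 : (i : ℕ) + 1 < n := by have := i.isLt; omega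
  have hlt := hmono.lt_iff_lt (a := (Tuple.sort f).symm ⟨(i : ℕ) + 1, h1⟩)
    (b := (Tuple.sort f).symm ⟨(i : ℕ), h0⟩)
  simp only [Function.comp_apply, Equiv.apply_symm_apply] at hlt
  simp only [des, Finset.mem_filter, Finset.mem_univ, true_and]
  rw [← hlt]
  simp only [f, hstep i h0 h1]
  split_ifs with hi
  · simp only [hi, iff_true]
    push_cast
    have : (2 : ℤ) ≤ n := by omega
    linarith
  · simp only [hi, iff_false]
    push_cast
    linarith

variable (k : Type*) [CommRing k]

/-- The sum of all permutations whose descent set is contained in `I`. -/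
noncomputable def B (I : Finset (Fin (n - 1))) : MonoidAlgebra k (Equiv.Perm (Fin n)) :=
  ∑ w : Equiv.Perm (Fin n) with des w ⊆ I, MonoidAlgebra.single w 1

/-- The sum of all permutations whose descent set is `I`. -/
noncomputable def D (I : Finset (Fin (n - 1))) : MonoidAlgebra k (Equiv.Perm (Fin n)) :=
  ∑ w : Equiv.Perm (Fin n) with des w = I, MonoidAlgebra.single w 1

/-- The descent algebra, as the `k`-submodule of the group algebra spanned by the `B I`. -/
noncomputable def descentAlgebra (n : ℕ) : Submodule k (MonoidAlgebra k (Equiv.Perm (Fin n))) :=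
  Submodule.span k (Set.range (B k))

theorem coeff_B (I : Finset (Fin (n - 1))) (w : Equiv.Perm (Fin n)) :
    (B k I).coeff w = if des w ⊆ I then 1 else 0 := by
  classical
  simp [B, MonoidAlgebra.coeff_sum, Finsupp.finsetSum_apply, Finsupp.single_apply,
    Finset.sum_ite_eq']

theorem linearIndependent_B :
    LinearIndependent k (B k : Finset (Fin (n - 1)) → MonoidAlgebra k (Equiv.Perm (Fin n))) := by
  classical
  rw [Fintype.linearIndependent_iff]
  intro g hg
  have key : ∀ J : Finset (Fin (n - 1)), ∑ I, (if J ⊆ I then g I else 0) = 0 := by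
    intro J
    obtain ⟨w, rfl⟩ := exists_des_eq J
    have := congrArg (fun x => x.coeff w) hg
    simpa [MonoidAlgebra.coeff_sum, Finsupp.finsetSum_apply, coeff_B] using this
  have main : ∀ m : ℕ, ∀ J : Finset (Fin (n - 1)), Jᶜ.card = m → g J = 0 := by
    intro m
    induction m using Nat.strong_induction_on with
    | _ m ih =>
      intro J hJ
      have h := key J
      rw [Finset.sum_eq_single J] at h
      · simpa using h
      · intro I _ hne
        split_ifs with hsub
        · refine ih _ ?_ I rfl
          rw [← hJ]
          apply Finset.card_lt_card
          rw [Finset.compl_ssubset_compl]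
          exact lt_of_le_of_ne hsub (Ne.symm hne)
        · rfl
      · simp
  exact fun J => main _ J rfl

theorem D_mem (J : Finset (Fin (n - 1))) : D k J ∈ descentAlgebra k n := by
  classical
  induction J using Finset.strongInduction with
  | _ J ih =>
    have h : B k J = ∑ I ∈ J.powerset, D k I := by
      simp only [B, D]
      rw [← Finset.sum_fiberwise_of_maps_to (t := J.powerset) (g := des)
        (fun w hw => Finset.mem_powerset.mpr (Finset.mem_filter.mp hw).2)]
      refine Finset.sum_congr rfl fun I hI => Finset.sum_congr ?_ fun _ _ => rfl
      ext w
      simp only [Finset.mem_filter, Finset.mem_univ, true_and]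
      constructor
      · exact fun h => h.2
      · rintro rfl
        exact ⟨Finset.mem_powerset.mp hI, rfl⟩
    have h2 : D k J = B k J - ∑ I ∈ J.ssubsets, D k I := by
      rw [h, Finset.ssubsets, ← Finset.add_sum_erase _ _ (Finset.mem_powerset_self J)]
      simp
    rw [h2]
    exact Submodule.sub_mem _ (Submodule.subset_span ⟨J, rfl⟩)
      (Submodule.sum_mem _ fun I hI => ih I (Finset.mem_ssubsets.mp hI))

/-- The permutation `i ↦ n + 1 - i` of `{1, …, n}`, as an element of the group algebra. -/
noncomputable def w0 (n : ℕ) : MonoidAlgebra k (Equiv.Perm (Fin n)) :=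
  MonoidAlgebra.single Fin.revPerm 1

theorem des_eq_univ_iff (w : Equiv.Perm (Fin n)) : des w = Finset.univ ↔ w = Fin.revPerm := by
  constructor
  · intro h
    have hstep : ∀ (i : ℕ) (h1 : i + 1 < n), w ⟨i + 1, h1⟩ < w ⟨i, by omega⟩ := by
      intro i h1
      have : (⟨i, by omega⟩ : Fin (n - 1)) ∈ des w := h ▸ Finset.mem_univ _
      simpa [des] using this
    have hanti : Antitone w := by
      have : ∀ (d i : ℕ) (h1 : i + d < n), w ⟨i + d, h1⟩ ≤ w ⟨i, by omega⟩ := by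
        intro d
        induction d with
        | zero => intro i h1; exact le_rfl
        | succ d ih => intro i h1; exact (hstep (i + d) h1).le.trans (ih i (by omega))
      intro a b hab
      have hab' : (a : ℕ) ≤ b := hab
      have := this ((b : ℕ) - a) a (by omega)
      have hb : (⟨(a : ℕ) + ((b : ℕ) - a), by omega⟩ : Fin n) = b :=
        Fin.ext (Nat.add_sub_cancel' hab')
      rwa [hb] at this
    have hm : Monotone (w * Fin.revPerm : Equiv.Perm (Fin n)) := by
      intro a b hab
      exact hanti (Fin.rev_le_rev.mpr hab)
    have := (Equiv.Perm.monotone_iff _).mp hm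
    ext i
    have hi := congrArg (fun σ : Equiv.Perm (Fin n) => σ (Fin.rev i)) this
    simp at hi
    simp [hi]
  · rintro rfl
    ext i
    simp only [des, Finset.mem_filter, Finset.mem_univ, true_and, iff_true, Fin.revPerm_apply,
      Fin.rev_lt_rev, Fin.mk_lt_mk]
    omega

theorem w0_mem : w0 k n ∈ descentAlgebra k n := by
  have h : w0 k n = D k Finset.univ := by
    simp only [w0, D, des_eq_univ_iff]
    rw [Finset.filter_eq' Finset.univ (Fin.revPerm : Equiv.Perm (Fin n)),
      if_pos (Finset.mem_univ _), Finset.sum_singleton]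
  exact h ▸ D_mem k _

/-- The `B`-basis of the descent algebra. -/
noncomputable def basisB (n : ℕ) : Module.Basis (Finset (Fin (n - 1))) k (descentAlgebra k n) :=
  Module.Basis.span (linearIndependent_B k)

/-- The `k`-linear map `ρ` from the descent algebra to the face algebra that sends each basis
element `B_α` to the sum of all faces of type `α`. -/
noncomputable def rho (n : ℕ) : descentAlgebra k n →ₗ[k] FaceAlgebra k n :=
  (basisB k n).constr k fun I => faceB k (gaps n I)

theorem rho_B (α : Composition n) :
    rho k n ⟨B k ((gaps n).symm α), Submodule.subset_span ⟨_, rfl⟩⟩ = faceB k α := by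
  have h : (⟨B k ((gaps n).symm α), Submodule.subset_span ⟨_, rfl⟩⟩ : descentAlgebra k n)
      = basisB k n ((gaps n).symm α) :=
    (Module.Basis.span_apply (linearIndependent_B k) _).symm
  rw [h, rho, Module.Basis.constr_basis, Equiv.apply_symm_apply]

/-- The image of `w0` under `ρ`. -/
noncomputable def w0Tilde (n : ℕ) : FaceAlgebra k n :=
  rho k n ⟨w0 k n, w0_mem k⟩

end DescentAlgebra

/-- The `k`-linear operator on the face algebra given by right multiplication by the product of
`w0Tilde` and `faceB k α`. -/
noncomputable def rightMulW0B (k : Type*) [CommRing k] {n : ℕ} (α : Composition n) :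
    Module.End k (FaceAlgebra k n) :=
  LinearMap.mulRight k (DescentAlgebra.w0Tilde k n * faceB k α)

theorem rightMulW0B_apply (k : Type*) [CommRing k] {n : ℕ} (α : Composition n)
    (x : FaceAlgebra k n) :
    rightMulW0B k α x = x * (DescentAlgebra.w0Tilde k n * faceB k α) := rfl

/-- A linear operator is diagonalizable if the space has a basis of eigenvectors. -/
def IsDiagonalizableOperator {k : Type*} [Field k] {V : Type*} [AddCommGroup V] [Module k V]
    (f : Module.End k V) : Prop :=
  ∃ (s : Set V) (b : Module.Basis s k V), ∀ i : s, ∃ c : k, f (b i) = c • b i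

/-! A face is the same as a weak order on `Fin n`, recorded by its block index `idx`. The product
becomes the lexicographic product (`idx_mul_lt`), `F * G = F` means that `F` is contained in `G`,
and `F * G = G` means that `G` refines the ordered face `F`.

Inclusion–exclusion over descent sets gives `w0Tilde = s`, where `s` is the sum of all faces with
sign `(-1) ^ (n - length)` (`w0Tilde_eq`). A sign-reversing involution computes `s * G`
(`sum_sign_of_mul_eq`). In particular `s` reverses every chamber, i.e. every face with singleton
blocks. Left multiplication on chambers is faithful, so `s * G * s = G.reverse`
(`signedFaceSum_mul_mul`).

Let `R` be right multiplication by `s * B`, with `B = faceB k α`. Then `R * R` is right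
multiplication by `(s * B * s) * B`, a sum of faces `G.reverse * G'` without signs. Such an operator
is triangular, with diagonal entries that strictly grow off the diagonal, hence diagonalizable
(`single_mem_iSup_eigenspace`); here its eigenvalues are the squares of the knapsack numbers. An
eigenspace of `R * R` for `c ^ 2 ≠ 0` splits into eigenspaces of `R` for `c` and `-c`. For the
eigenvalue `0` one needs `ker (R * R) = ker R`: the range of `R` lies in the span of faces with
nonzero knapsack number, which meets the kernel of `R * R` trivially.

Eigenvalues and multiplicities come from the characteristic polynomial. Right multiplication by any
`b` is triangular for the length of faces, with the characters `faceCharacter k F b` on the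
diagonal; these send `s` to the sign of `F` and `B` to its knapsack number. -/

/-! ## Faces as weak orders -/

namespace SetComposition

variable {n : ℕ}

/-- `x` lies in some set of the list `l`. -/
def Covers (l : List (Finset (Fin n))) (x : Fin n) : Prop := ∃ A ∈ l, x ∈ A

/-- `x` lies in a set of the list `l` that comes strictly before a set that contains `y`. -/
def Precedes : List (Finset (Fin n)) → Fin n → Fin n → Prop
  | [], _, _ => False
  | A :: l, x, y => (x ∈ A ∧ Covers l y) ∨ Precedes l x y

theorem covers_nil (x : Fin n) : ¬ Covers [] x := by simp [Covers]

theorem covers_cons {A : Finset (Fin n)} {l : List (Finset (Fin n))} {x : Fin n} :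
    Covers (A :: l) x ↔ x ∈ A ∨ Covers l x := by simp [Covers]

theorem covers_append {l m : List (Finset (Fin n))} {x : Fin n} :
    Covers (l ++ m) x ↔ Covers l x ∨ Covers m x := by
  simp [Covers, or_and_right, exists_or]

theorem covers_map_inter {A : Finset (Fin n)} {m : List (Finset (Fin n))} {x : Fin n} :
    Covers (m.map fun B => A ∩ B) x ↔ x ∈ A ∧ Covers m x := by
  simp only [Covers, List.mem_map]
  constructor
  · rintro ⟨_, ⟨B, hB, rfl⟩, hx⟩
    rw [Finset.mem_inter] at hx
    exact ⟨hx.1, B, hB, hx.2⟩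
  · rintro ⟨hA, B, hB, hx⟩
    exact ⟨A ∩ B, ⟨B, hB, rfl⟩, Finset.mem_inter.2 ⟨hA, hx⟩⟩

theorem covers_inters {l m : List (Finset (Fin n))} {x : Fin n} :
    Covers (inters l m) x ↔ Covers l x ∧ Covers m x := by
  induction l with
  | nil => simp [inters, covers_nil]
  | cons A l ih =>
    have : inters (A :: l) m = m.map (fun B => A ∩ B) ++ inters l m := rfl
    rw [this, covers_append, covers_map_inter, ih, covers_cons]
    tauto

theorem covers_red {l : List (Finset (Fin n))} {x : Fin n} : Covers (red l) x ↔ Covers l x := by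
  simp only [Covers, mem_red]
  constructor
  · rintro ⟨A, hA, hx⟩
    exact ⟨A, hA.1, hx⟩
  · rintro ⟨A, hA, hx⟩
    exact ⟨A, ⟨hA, x, hx⟩, hx⟩

theorem Precedes.covers_left {l : List (Finset (Fin n))} {x y : Fin n} (h : Precedes l x y) :
    Covers l x := by
  induction l with
  | nil => exact h.elim
  | cons A l ih =>
    rw [covers_cons]
    exact h.imp And.left ih

theorem Precedes.covers_right {l : List (Finset (Fin n))} {x y : Fin n} (h : Precedes l x y) :
    Covers l y := by
  induction l with
  | nil => exact h.elim
  | cons A l ih =>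
    rw [covers_cons]
    exact Or.inr (h.elim And.right ih)

theorem precedes_append {l m : List (Finset (Fin n))} {x y : Fin n} :
    Precedes (l ++ m) x y ↔ Precedes l x y ∨ Precedes m x y ∨ (Covers l x ∧ Covers m y) := by
  induction l with
  | nil => simp [Precedes, covers_nil]
  | cons A l ih =>
    simp only [List.cons_append, Precedes, ih, covers_append, covers_cons]
    tauto

theorem precedes_red {l : List (Finset (Fin n))} {x y : Fin n} :
    Precedes (red l) x y ↔ Precedes l x y := by
  induction l with
  | nil => rfl
  | cons A l ih =>
    by_cases hA : A.Nonempty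
    · have : red (A :: l) = A :: red l := by simp [red, hA]
      rw [this]
      simp only [Precedes, ih, covers_red]
    · have h1 : red (A :: l) = red l := by simp [red, hA]
      rw [h1, ih]
      simp [Precedes, Finset.not_nonempty_iff_eq_empty.mp hA]

theorem precedes_map_inter {A : Finset (Fin n)} {m : List (Finset (Fin n))} {x y : Fin n} :
    Precedes (m.map fun B => A ∩ B) x y ↔ x ∈ A ∧ y ∈ A ∧ Precedes m x y := by
  induction m with
  | nil => simp [Precedes]
  | cons B m ih =>
    simp only [List.map_cons, Precedes, ih, covers_map_inter, Finset.mem_inter]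
    tauto

/-- The lexicographic rule at the level of lists: `m` decides only inside a common set of `l`.
Disjointness plays no role here, which allows plain induction on `l`. -/
theorem precedes_inters {l m : List (Finset (Fin n))} {x y : Fin n} :
    Precedes (inters l m) x y ↔ (Precedes l x y ∧ Covers m x ∧ Covers m y) ∨
      ((∃ A ∈ l, x ∈ A ∧ y ∈ A) ∧ Precedes m x y) := by
  induction l with
  | nil => simp [inters, Precedes]
  | cons A l ih =>
    have : inters (A :: l) m = m.map (fun B => A ∩ B) ++ inters l m := rfl
    simp only [this, precedes_append, precedes_map_inter, ih, covers_map_inter, covers_inters,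
      Precedes, List.exists_mem_cons_iff]
    constructor
    · rintro (⟨hx, hy, h⟩ | h | ⟨⟨hx, hmx⟩, hy, hmy⟩)
      · exact Or.inr ⟨Or.inl ⟨hx, hy⟩, h⟩
      · exact h.imp (And.imp_left Or.inr) (And.imp_left Or.inr)
      · exact Or.inl ⟨Or.inl ⟨hx, hy⟩, hmx, hmy⟩
    · rintro (⟨⟨hx, hy⟩ | h, hmx, hmy⟩ | ⟨⟨hx, hy⟩ | h, hm⟩)
      · exact Or.inr (Or.inr ⟨⟨hx, hmx⟩, hy, hmy⟩)
      · exact Or.inr (Or.inl (Or.inl ⟨h, hmx, hmy⟩))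
      · exact Or.inl ⟨hx, hy, hm⟩
      · exact Or.inr (Or.inl (Or.inr ⟨h, hm⟩))

theorem precedes_iff_findIdx_lt {l : List (Finset (Fin n))} (hl : l.Pairwise Disjoint)
    {x y : Fin n} (hy : Covers l y) :
    Precedes l x y ↔ l.findIdx (x ∈ ·) < l.findIdx (y ∈ ·) := by
  induction l with
  | nil => exact (covers_nil y hy).elim
  | cons A l ih =>
    rw [List.pairwise_cons] at hl
    have hd : ∀ z ∈ A, ¬ Covers l z := fun z hz ⟨B, hB, hzB⟩ =>
      Finset.disjoint_left.mp (hl.1 B hB) hz hzB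
    rw [covers_cons] at hy
    simp only [Precedes, List.findIdx_cons]
    by_cases hxA : x ∈ A <;> by_cases hyA : y ∈ A
    · have h : ¬ Precedes l x y := fun h => hd _ hxA h.covers_left
      simp [hxA, hyA, hd y hyA, h]
    · simp [hxA, hyA, hy.resolve_left hyA]
    · have h : ¬ Precedes l x y := fun h => hd _ hyA h.covers_right
      simp [hxA, hyA, h]
    · simp [hxA, hyA, ih hl.2 (hy.resolve_left hyA)]

/-! ### Block indices and the lexicographic product -/

/-- The position of the block of `F` that contains `x`. -/
def idx (F : SetComposition n) (x : Fin n) : ℕ := F.blocks.findIdx (x ∈ ·)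

theorem precedes_blocks {F : SetComposition n} {x y : Fin n} :
    Precedes F.blocks x y ↔ F.idx x < F.idx y :=
  precedes_iff_findIdx_lt F.pairwise_disjoint (F.exists_mem y)

theorem idx_lt_length (F : SetComposition n) (x : Fin n) : F.idx x < F.length := by
  obtain ⟨A, hA, hx⟩ := F.exists_mem x
  exact List.findIdx_lt_length_of_exists ⟨A, hA, by simpa using hx⟩

theorem mem_blocks_idx (F : SetComposition n) (x : Fin n) :
    x ∈ F.blocks[F.idx x]'(F.idx_lt_length x) := by
  exact of_decide_eq_true
    (List.findIdx_getElem (p := fun A => decide (x ∈ A)) (w := F.idx_lt_length x))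

theorem idx_eq_of_mem (F : SetComposition n) {x : Fin n} {i : ℕ} (hi : i < F.blocks.length)
    (hx : x ∈ F.blocks[i]) : F.idx x = i := by
  have hp := List.pairwise_iff_getElem.mp F.pairwise_disjoint
  have h1 := F.idx_lt_length x
  have h2 := F.mem_blocks_idx x
  rcases lt_trichotomy (F.idx x) i with h | h | h
  · exact (Finset.disjoint_left.mp (hp _ _ h1 hi h) h2 hx).elim
  · exact h
  · exact (Finset.disjoint_left.mp (hp _ _ hi h1 h) hx h2).elim

theorem exists_mem_blocks_iff (F : SetComposition n) (x y : Fin n) :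
    (∃ A ∈ F.blocks, x ∈ A ∧ y ∈ A) ↔ F.idx x = F.idx y := by
  constructor
  · rintro ⟨A, hA, hx, hy⟩
    obtain ⟨i, hi, rfl⟩ := List.mem_iff_getElem.mp hA
    rw [F.idx_eq_of_mem hi hx, F.idx_eq_of_mem hi hy]
  · intro h
    refine ⟨_, List.getElem_mem (F.idx_lt_length x), F.mem_blocks_idx x, ?_⟩
    have := F.mem_blocks_idx y
    simp only [← h] at this
    exact this

theorem exists_idx_eq (F : SetComposition n) {i : ℕ} (hi : i < F.length) : ∃ x, F.idx x = i := by
  obtain ⟨x, hx⟩ := F.nonempty_of_mem _ (List.getElem_mem hi)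
  exact ⟨x, F.idx_eq_of_mem hi hx⟩

theorem image_idx (F : SetComposition n) : Finset.univ.image F.idx = Finset.range F.length := by
  ext i
  simp only [Finset.mem_image, Finset.mem_univ, true_and, Finset.mem_range]
  exact ⟨fun ⟨x, hx⟩ => hx ▸ F.idx_lt_length x, fun h => F.exists_idx_eq h⟩

/-- Removing empty intersections does not affect `Precedes`, so the list-level rule passes to faces.
With `ext_idx`, this turns many identities between faces into integer arithmetic on indices. -/
theorem idx_mul_lt (F G : SetComposition n) (x y : Fin n) :
    (F * G).idx x < (F * G).idx y ↔
      F.idx x < F.idx y ∨ (F.idx x = F.idx y ∧ G.idx x < G.idx y) := by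
  rw [← precedes_blocks, mul_blocks, precedes_red, precedes_inters, precedes_blocks,
    precedes_blocks, exists_mem_blocks_iff]
  have hx : Covers G.blocks x := G.exists_mem x
  have hy : Covers G.blocks y := G.exists_mem y
  tauto

theorem idx_mul_eq (F G : SetComposition n) (x y : Fin n) :
    (F * G).idx x = (F * G).idx y ↔ F.idx x = F.idx y ∧ G.idx x = G.idx y := by
  have h1 := F.idx_mul_lt G x y
  have h2 := F.idx_mul_lt G y x
  omega

theorem blocks_eq_of_precedes {l m : List (Finset (Fin n))}
    (hl : l.Pairwise Disjoint) (hm : m.Pairwise Disjoint)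
    (hl' : ∀ A ∈ l, A.Nonempty) (hm' : ∀ A ∈ m, A.Nonempty)
    (hc : ∀ x, Covers l x ↔ Covers m x) (h : ∀ x y, Precedes l x y ↔ Precedes m x y) :
    l = m := by
  -- The head of the list is the set of minimal covered elements, and both relations of the tail are
  -- those of the whole list off the head; so the list can be rebuilt block by block.
  have key : ∀ (A : Finset (Fin n)) (l : List (Finset (Fin n))), (A :: l).Pairwise Disjoint →
      A.Nonempty → (∀ x, x ∈ A ↔ Covers (A :: l) x ∧ ∀ y, ¬ Precedes (A :: l) y x) ∧
      (∀ x, Covers l x ↔ Covers (A :: l) x ∧ x ∉ A) ∧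
      (∀ x y, Precedes l x y ↔ Precedes (A :: l) x y ∧ x ∉ A) := by
    intro A l hl hA
    rw [List.pairwise_cons] at hl
    have hd : ∀ z ∈ A, ¬ Covers l z := fun z hz ⟨B, hB, hzB⟩ =>
      Finset.disjoint_left.mp (hl.1 B hB) hz hzB
    refine ⟨fun x => ⟨fun hx => ⟨covers_cons.2 (Or.inl hx), fun y hy => ?_⟩, fun hx => ?_⟩,
      fun x => ?_, fun x y => ?_⟩
    · exact hd x hx (hy.elim And.right Precedes.covers_right)
    · obtain ⟨z, hz⟩ := hA
      refine (covers_cons.1 hx.1).resolve_right fun hc => hx.2 z (Or.inl ⟨hz, hc⟩)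
    · have := hd x
      rw [covers_cons]
      tauto
    · have := fun hx => mt (Precedes.covers_left (l := l) (x := x) (y := y)) (hd x hx)
      simp only [Precedes]
      tauto
  induction l generalizing m with
  | nil =>
    cases m with
    | nil => rfl
    | cons B m =>
      obtain ⟨z, hz⟩ := hm' B List.mem_cons_self
      exact (covers_nil z ((hc z).2 (covers_cons.2 (Or.inl hz)))).elim
  | cons A l ih =>
    cases m with
    | nil =>
      obtain ⟨z, hz⟩ := hl' A List.mem_cons_self
      exact (covers_nil z ((hc z).1 (covers_cons.2 (Or.inl hz)))).elim
    | cons B m =>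
      obtain ⟨a1, a2, a3⟩ := key A l hl (hl' A List.mem_cons_self)
      obtain ⟨b1, b2, b3⟩ := key B m hm (hm' B List.mem_cons_self)
      have hAB : A = B := by
        ext x
        rw [a1, b1, hc]
        simp only [h]
      subst hAB
      congr 1
      refine ih (List.pairwise_cons.1 hl).2 (List.pairwise_cons.1 hm).2
        (fun C hC => hl' C (List.mem_cons_of_mem _ hC))
        (fun C hC => hm' C (List.mem_cons_of_mem _ hC)) (fun x => ?_) (fun x y => ?_)
      · rw [a2, b2, hc]
      · rw [a3, b3, h]

theorem ext_idx {F G : SetComposition n}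
    (h : ∀ x y, F.idx x < F.idx y ↔ G.idx x < G.idx y) : F = G := by
  refine SetComposition.ext (blocks_eq_of_precedes F.pairwise_disjoint G.pairwise_disjoint
    F.nonempty_of_mem G.nonempty_of_mem (fun x => ?_) fun x y => ?_)
  · exact iff_of_true (F.exists_mem x) (G.exists_mem x)
  · rw [precedes_blocks, precedes_blocks, h]

/-! ### Faces built from functions, and their lengths -/

/-- The list of the fibres of `f` over `0, 1, …, N - 1`. -/
def fibres (f : Fin n → ℕ) (N : ℕ) : List (Finset (Fin n)) :=
  (List.range N).map fun i => Finset.univ.filter fun x => f x = i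

theorem covers_fibres {f : Fin n → ℕ} {N : ℕ} {x : Fin n} : Covers (fibres f N) x ↔ f x < N := by
  simp [Covers, fibres]

theorem precedes_fibres {f : Fin n → ℕ} {N : ℕ} {x y : Fin n} :
    Precedes (fibres f N) x y ↔ f x < f y ∧ f y < N := by
  induction N with
  | zero => simp [fibres, Precedes]
  | succ N ih =>
    have : fibres f (N + 1) = fibres f N ++ [Finset.univ.filter fun x => f x = N] := by
      simp [fibres, List.range_succ]
    rw [this, precedes_append, ih, covers_fibres]
    simp only [Precedes, covers_nil, covers_cons, Finset.mem_filter, Finset.mem_univ, true_and,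
      and_false, or_false, false_or]
    omega

/-- The face whose blocks are the nonempty fibres of `f`, in increasing order. -/
def ofFun (f : Fin n → ℕ) : SetComposition n where
  blocks := red (fibres f (Finset.univ.sup f + 1))
  nonempty_of_mem := fun A hA => (mem_red.mp hA).2
  pairwise_disjoint := by
    refine List.Pairwise.filter _ ?_
    rw [fibres, List.pairwise_map]
    refine List.nodup_range.imp fun {a b} hab => ?_
    rw [Finset.disjoint_left]
    intro x hx hx'
    exact hab ((Finset.mem_filter.1 hx).2.symm.trans (Finset.mem_filter.1 hx').2)
  exists_mem := fun x => covers_red.2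
    (covers_fibres.2 (Nat.lt_succ_of_le (Finset.le_sup (Finset.mem_univ x))))

theorem idx_ofFun_lt (f : Fin n → ℕ) (x y : Fin n) :
    (ofFun f).idx x < (ofFun f).idx y ↔ f x < f y := by
  have hy : f y < Finset.univ.sup f + 1 :=
    Nat.lt_succ_of_le (Finset.le_sup (f := f) (Finset.mem_univ y))
  rw [← precedes_blocks]
  change Precedes (red _) x y ↔ _
  rw [precedes_red, precedes_fibres]
  exact and_iff_left hy

theorem card_image_le_of_imp {f g : Fin n → ℕ} (h : ∀ x y, f x = f y → g x = g y) :
    (Finset.univ.image g).card ≤ (Finset.univ.image f).card := by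
  -- `g` factors through `f`; the default value `0` is never taken on the image of `f`.
  have hg : Finset.univ.image g =
      (Finset.univ.image f).image (fun i => if hi : ∃ x, f x = i then g hi.choose else 0) := by
    rw [Finset.image_image]
    refine Finset.image_congr fun x _ => ?_
    have hx : ∃ y, f y = f x := ⟨x, rfl⟩
    simp only [Function.comp_apply, dif_pos hx]
    exact (h _ _ hx.choose_spec).symm
  rw [hg]
  exact Finset.card_image_le

theorem length_eq_card (F : SetComposition n) : F.length = (Finset.univ.image F.idx).card := by
  rw [image_idx, Finset.card_range]

theorem length_ofFun (f : Fin n → ℕ) : (ofFun f).length = (Finset.univ.image f).card := by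
  rw [length_eq_card]
  have h : ∀ x y, (ofFun f).idx x = (ofFun f).idx y ↔ f x = f y := fun x y => by
    have h1 := idx_ofFun_lt f x y
    have h2 := idx_ofFun_lt f y x
    omega
  exact le_antisymm (card_image_le_of_imp fun x y => (h x y).2)
    (card_image_le_of_imp fun x y => (h x y).1)

theorem length_le_of_imp {F G : SetComposition n}
    (h : ∀ x y, F.idx x = F.idx y → G.idx x = G.idx y) : G.length ≤ F.length := by
  rw [length_eq_card, length_eq_card]
  exact card_image_le_of_imp h

/-! ### Refinement and containment -/

/-- `F * G = G` means that `G` refines `F`, as a weak order. -/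
theorem mul_eq_right_iff {F G : SetComposition n} :
    F * G = G ↔ ∀ x y, F.idx x < F.idx y → G.idx x < G.idx y := by
  constructor
  · intro h x y hxy
    rw [← h, idx_mul_lt]
    exact Or.inl hxy
  · intro h
    refine ext_idx fun x y => ?_
    rw [idx_mul_lt]
    have h1 := h x y
    have h2 := h y x
    omega

theorem mul_eq_left_iff {F G : SetComposition n} :
    F * G = F ↔ ∀ x y, F.idx x = F.idx y → G.idx x = G.idx y := by
  constructor
  · intro h x y hxy
    rw [← h, idx_mul_eq] at hxy
    exact hxy.2
  · intro h
    refine ext_idx fun x y => ?_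
    rw [idx_mul_lt]
    have := h x y
    omega

theorem containedIn_iff_mul_eq {F G : SetComposition n} : F.ContainedIn G ↔ F * G = F := by
  rw [mul_eq_left_iff]
  constructor
  · intro h x y hxy
    obtain ⟨A, hA, hx, hy⟩ := (F.exists_mem_blocks_iff x y).2 hxy
    obtain ⟨B, hB, hAB⟩ := h A hA
    exact (G.exists_mem_blocks_iff x y).1 ⟨B, hB, hAB hx, hAB hy⟩
  · intro h A hA
    obtain ⟨x, hx⟩ := F.nonempty_of_mem A hA
    refine ⟨_, List.getElem_mem (G.idx_lt_length x), fun y hy => ?_⟩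
    have := G.mem_blocks_idx y
    simp only [← h x y ((F.exists_mem_blocks_iff x y).1 ⟨A, hA, hx, hy⟩)] at this
    exact this

theorem mul_self (F : SetComposition n) : F * F = F :=
  mul_eq_right_iff.2 fun _ _ h => h

theorem mul_mul_self_left (F G : SetComposition n) : F * (F * G) = F * G := by
  rw [← mul_assoc, mul_self]

theorem length_le_length_mul (F G : SetComposition n) : F.length ≤ (F * G).length :=
  length_le_of_imp fun x y h => ((idx_mul_eq F G x y).1 h).1

/-- A refinement of a face that has the same length is the face itself. -/
theorem eq_of_mul_eq_of_length_le {F H : SetComposition n} (h : F * H = H)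
    (hl : H.length ≤ F.length) : H = F := by
  have himp : ∀ x y, H.idx x = H.idx y → F.idx x = F.idx y := fun x y hxy => by
    rw [← h, idx_mul_eq] at hxy
    exact hxy.1
  have hmono := mul_eq_right_iff.1 h
  let φ : ℕ → ℕ := fun i => if hi : ∃ x, H.idx x = i then F.idx hi.choose else 0
  have hφ : ∀ x, φ (H.idx x) = F.idx x := fun x => by
    have hx : ∃ y, H.idx y = H.idx x := ⟨x, rfl⟩
    simp only [φ, dif_pos hx]
    exact himp _ _ hx.choose_spec
  have himage : (Finset.univ.image H.idx).image φ = Finset.univ.image F.idx := by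
    rw [Finset.image_image]
    exact Finset.image_congr fun x _ => hφ x
  -- `φ` sends a block of `H` to the block of `F` around it. It is onto the indices of `F`, and the
  -- lengths agree, so it is injective.
  have hinj : Set.InjOn φ (Finset.univ.image H.idx) := by
    rw [← Finset.card_image_iff, himage, ← length_eq_card, ← length_eq_card]
    refine le_antisymm ?_ hl
    rw [← h]
    exact length_le_length_mul F H
  refine ext_idx fun x y => ?_
  have hxy : F.idx x = F.idx y → H.idx x = H.idx y := fun e =>
    hinj (by simp) (by simp) (by rw [hφ, hφ, e])
  have h1 := hmono x y
  have h2 := hmono y x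
  have h3 := himp x y
  omega

theorem length_lt_length_mul {F G : SetComposition n} (h : F * G ≠ F) :
    F.length < (F * G).length := by
  by_contra hlt
  exact h (eq_of_mul_eq_of_length_le (mul_mul_self_left F G) (not_lt.1 hlt))

/-! ### Reversal -/

/-- The face with the blocks of `F` in the opposite order. -/
def reverse (F : SetComposition n) : SetComposition n := ofFun fun x => F.length - F.idx x

theorem idx_reverse_lt (F : SetComposition n) (x y : Fin n) :
    F.reverse.idx x < F.reverse.idx y ↔ F.idx y < F.idx x := by
  rw [reverse, idx_ofFun_lt]
  have h1 := F.idx_lt_length x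
  have h2 := F.idx_lt_length y
  omega

theorem idx_reverse_eq (F : SetComposition n) (x y : Fin n) :
    F.reverse.idx x = F.reverse.idx y ↔ F.idx x = F.idx y := by
  have h1 := F.idx_reverse_lt x y
  have h2 := F.idx_reverse_lt y x
  omega

theorem reverse_reverse (F : SetComposition n) : F.reverse.reverse = F :=
  ext_idx fun x y => by rw [idx_reverse_lt, idx_reverse_lt]

theorem reverse_mul (F G : SetComposition n) : (F * G).reverse = F.reverse * G.reverse :=
  ext_idx fun x y => by
    rw [idx_reverse_lt, idx_mul_lt, idx_mul_lt, idx_reverse_lt, idx_reverse_lt, idx_reverse_eq,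
      eq_comm]

theorem mul_reverse_eq_left_iff {F G : SetComposition n} : F * G.reverse = F ↔ F * G = F := by
  simp only [mul_eq_left_iff, idx_reverse_eq]

end SetComposition

/-! ## Signed sums over faces -/

namespace SetComposition

variable {n : ℕ}

/-- Cut the blocks of `F` after the block of `H` that contains `u`. -/
def split (H : SetComposition n) (u : Fin n) (F : SetComposition n) : SetComposition n :=
  ofFun fun x => if H.idx u < H.idx x then F.idx x + 1 else F.idx x

/-- Move the block of `F` that contains `v` to the one that contains `u`. -/
def merge (u v : Fin n) (F : SetComposition n) : SetComposition n :=
  ofFun fun x => if F.idx x = F.idx v then F.idx u else F.idx x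

section toggle

variable {F G H : SetComposition n} {u v : Fin n}

theorem idx_le_of_mul_eq_right (h : F * H = H) {x y : Fin n} (hxy : H.idx x ≤ H.idx y) :
    F.idx x ≤ F.idx y := by
  by_contra hlt
  have := mul_eq_right_iff.1 h y x (by omega)
  omega

/-- Since `H` refines `F`, the shift respects the strict order of `F`; only ties of `F` that
straddle the cut are broken. -/
theorem split_lt_iff (h : F * H = H) (x y : Fin n) :
    (split H u F).idx x < (split H u F).idx y ↔
      F.idx x < F.idx y ∨ (F.idx x = F.idx y ∧ H.idx x ≤ H.idx u ∧ H.idx u < H.idx y) := by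
  rw [split, idx_ofFun_lt]
  have h1 := mul_eq_right_iff.1 h x y
  have h2 := mul_eq_right_iff.1 h y x
  split_ifs <;> omega

/-- A block of `F` strictly between those of `u` and `v` would put a block of `H` strictly between
two consecutive ones. -/
theorem idx_eq_succ (h : F * H = H) (hv : H.idx v = H.idx u + 1) (hF : F.idx u < F.idx v) :
    F.idx v = F.idx u + 1 := by
  by_contra hne
  obtain ⟨z, hz⟩ := F.exists_idx_eq (i := F.idx u + 1) (by have := F.idx_lt_length v; omega)
  have h1 := mul_eq_right_iff.1 h u z (by omega)
  have h2 := mul_eq_right_iff.1 h z v (by omega)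
  omega

theorem merge_lt_iff (h : F * H = H) (hv : H.idx v = H.idx u + 1) (hF : F.idx u < F.idx v)
    (x y : Fin n) : (merge u v F).idx x < (merge u v F).idx y ↔
      F.idx x < F.idx y ∧ ¬ (F.idx x = F.idx u ∧ F.idx y = F.idx v) := by
  rw [merge, idx_ofFun_lt]
  have := idx_eq_succ h hv hF
  split_ifs <;> omega

theorem length_split (h : F * H = H) (hv : H.idx v = H.idx u + 1) (hF : F.idx u = F.idx v) :
    (split H u F).length = F.length + 1 := by
  rw [split, length_ofFun]
  have hm := mul_eq_right_iff.1 h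
  have : Finset.univ.image (fun x => if H.idx u < H.idx x then F.idx x + 1 else F.idx x) =
      Finset.range (F.length + 1) := by
    ext j
    simp only [Finset.mem_image, Finset.mem_univ, true_and, Finset.mem_range]
    constructor
    · rintro ⟨x, rfl⟩
      have := F.idx_lt_length x
      split_ifs <;> omega
    · intro hj
      have hu := F.idx_lt_length u
      -- Indices up to that of `u` stay, the new index is attained at `v`, and larger ones come from
      -- a shift by one.
      rcases lt_trichotomy j (F.idx u) with hlt | rfl | hgt
      · obtain ⟨x, hx⟩ := F.exists_idx_eq (i := j) (by omega)
        refine ⟨x, ?_⟩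
        have := hm x u (by omega)
        rw [if_neg (by omega), hx]
      · exact ⟨u, by simp⟩
      · rcases Nat.lt_or_ge (F.idx u + 1) j with hlt | hle
        · obtain ⟨x, hx⟩ := F.exists_idx_eq (i := j - 1) (by omega)
          refine ⟨x, ?_⟩
          have := hm u x (by omega)
          rw [if_pos (by omega)]
          omega
        · refine ⟨v, ?_⟩
          rw [if_pos (by omega)]
          omega
  rw [this, Finset.card_range]

theorem mul_eq_of_mul_eq (h : F * G = H) : F * H = H ∧ H * G = H := by
  subst h
  exact ⟨mul_mul_self_left F G, by rw [mul_assoc, mul_self]⟩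

/-- The added cut is already present in `H`, so `G` makes it anyway. -/
theorem split_mul (h : F * G = H) (u : Fin n) :
    split H u F * G = H := by
  obtain ⟨h1, h2⟩ := mul_eq_of_mul_eq h
  refine ext_idx fun x y => ?_
  have a1 := split_lt_iff (u := u) h1 x y
  have a2 := split_lt_iff (u := u) h1 y x
  have b1 := idx_mul_lt F G x y
  rw [h] at b1
  have b2 := idx_mul_lt F G y x
  rw [h] at b2
  rw [idx_mul_lt]
  omega

theorem merge_mul (h : F * G = H) (hv : H.idx v = H.idx u + 1) (hG : G.idx u < G.idx v)
    (hF : F.idx u < F.idx v) : merge u v F * G = H := by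
  obtain ⟨h1, h2⟩ := mul_eq_of_mul_eq h
  refine ext_idx fun x y => ?_
  have hFs := idx_eq_succ h1 hv hF
  have hGH := mul_eq_left_iff.1 h2
  -- In `H`, `x` is not after `u` and `y` not before `v`. Inside a block of `F` the order of `H` is
  -- that of `G`, so `G.idx x ≤ G.idx u < G.idx v ≤ G.idx y`: after the merge, `G` still separates
  -- the two blocks correctly.
  have key : ∀ x y, F.idx x = F.idx u → F.idx y = F.idx v →
      G.idx x < G.idx y ∧ H.idx x < H.idx y := by
    intro x y hx hy
    have c1 := idx_mul_lt F G u x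
    have c2 := idx_mul_lt F G y v
    have c3 := mul_eq_right_iff.1 h1 x v (by omega)
    have c4 := mul_eq_right_iff.1 h1 u y (by omega)
    have c5 := mul_eq_right_iff.1 h1 x y (by omega)
    rw [h] at c1 c2
    have c6 := hGH x u
    have c7 := hGH y v
    omega
  have k1 := key x y
  have k2 := key y x
  have a1 := merge_lt_iff h1 hv hF x y
  have a2 := merge_lt_iff h1 hv hF y x
  have b1 := idx_mul_lt F G x y
  rw [h] at b1
  rw [idx_mul_lt]
  omega

theorem split_idx_lt (h : F * H = H) (hv : H.idx v = H.idx u + 1) (hF : F.idx u = F.idx v) :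
    (split H u F).idx u < (split H u F).idx v := by
  rw [split_lt_iff h]
  omega

theorem merge_idx_eq (h : F * H = H) (hv : H.idx v = H.idx u + 1) (hF : F.idx u < F.idx v) :
    (merge u v F).idx u = (merge u v F).idx v := by
  have h1 := merge_lt_iff h hv hF u v
  have h2 := merge_lt_iff h hv hF v u
  omega

theorem merge_split (h : F * H = H) (h' : split H u F * H = H) (hv : H.idx v = H.idx u + 1)
    (hF : F.idx u = F.idx v) : merge u v (split H u F) = F := by
  refine ext_idx fun x y => ?_
  rw [merge_lt_iff h' hv (split_idx_lt h hv hF)]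
  have a := fun x y => split_lt_iff (u := u) h x y
  have m := fun x y => mul_eq_right_iff.1 h x y
  have a1 := a x y
  have a2 := a x u
  have a3 := a u x
  have a4 := a y v
  have a5 := a v y
  have m1 := m x u
  have m2 := m u x
  have m3 := m y v
  have m4 := m v y
  have m5 := m x y
  have m6 := m y x
  omega

theorem split_merge (h : F * H = H) (h' : merge u v F * H = H) (hv : H.idx v = H.idx u + 1)
    (hF : F.idx u < F.idx v) : split H u (merge u v F) = F := by
  refine ext_idx fun x y => ?_
  rw [split_lt_iff h']
  have hFs := idx_eq_succ h hv hF
  have a1 := merge_lt_iff h hv hF x y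
  have a2 := merge_lt_iff h hv hF y x
  have m := fun x y => mul_eq_right_iff.1 h x y
  have m1 := m x u
  have m2 := m u x
  have m3 := m y v
  have m4 := m v y
  have m5 := m x y
  have m6 := m y x
  have m7 := m u y
  have m8 := m x v
  omega

end toggle

/-- `G` is constant on the blocks of `H`. If it never increased between consecutive blocks, it would
be weakly decreasing along `H`, and `H` would refine `G.reverse`. -/
theorem exists_ascent {G H : SetComposition n} (hHG : H * G = H) (h : G.reverse * H ≠ H) :
    ∃ u v, H.idx v = H.idx u + 1 ∧ G.idx u < G.idx v := by
  by_contra! hno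
  have hc := mul_eq_left_iff.1 hHG
  have key : ∀ d x y, H.idx x = H.idx y + d → G.idx x ≤ G.idx y := by
    intro d
    induction d with
    | zero => exact fun x y hxy => (hc x y hxy).le
    | succ d ih =>
      intro x y hxy
      obtain ⟨z, hz⟩ := H.exists_idx_eq (i := H.idx y + d) (by have := H.idx_lt_length x; omega)
      exact (hno z x (by omega)).trans (ih z y hz)
  refine h (mul_eq_right_iff.2 fun x y hxy => ?_)
  rw [idx_reverse_lt] at hxy
  by_contra hle
  have := key (H.idx x - H.idx y) x y (by omega)
  omega

variable (k : Type*) [CommRing k]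

/-- The sign attached to a face. -/
def sign (F : SetComposition n) : k := (-1) ^ (n - F.length)

open Classical in
/-- The signed number of faces `F` with `F * G = H`. -/
theorem sum_sign_of_mul_eq (G H : SetComposition n) :
    ∑ F : SetComposition n with F * G = H, F.sign k =
      if G.reverse * H = H then H.sign k else 0 := by
  split_ifs with hrev
  · have hHG : H * G = H := by
      rw [← mul_reverse_eq_left_iff, mul_eq_left_iff]
      intro x y hxy
      have h1 := mul_eq_right_iff.1 hrev x y
      have h2 := mul_eq_right_iff.1 hrev y x
      omega
    rw [Finset.sum_eq_single_of_mem H (by simpa using hHG)]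
    intro F hF hne
    -- A tie of `F` is ordered in `F * G = H` as in `G`, while `H` orders it oppositely; so it is a
    -- tie of `H`, and `F` equals `H`.
    refine (hne (ext_idx fun x y => ?_)).elim
    have hF' := (Finset.mem_filter.1 hF).2
    have a1 := idx_mul_lt F G x y
    have a2 := idx_mul_lt F G y x
    rw [hF'] at a1 a2
    have r1 := mul_eq_right_iff.1 hrev x y
    have r2 := mul_eq_right_iff.1 hrev y x
    rw [idx_reverse_lt] at r1 r2
    omega
  · by_cases hHG : H * G = H
    · obtain ⟨u, v, hv, hG⟩ := exists_ascent hHG hrev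
      -- The involution toggles the cut between the consecutive blocks of `u` and `v`; `G` restores
      -- the cut when `F` lacks it, and the length changes by one.
      rw [← Finset.sum_filter_add_sum_filter_not _ fun F : SetComposition n => F.idx u = F.idx v,
        ← eq_neg_iff_add_eq_zero, ← Finset.sum_neg_distrib]
      have hlt : ∀ F : SetComposition n, F * G = H → ¬ F.idx u = F.idx v → F.idx u < F.idx v := by
        intro F hF hne
        have := idx_le_of_mul_eq_right (mul_eq_of_mul_eq hF).1 (x := u) (y := v) (by omega)
        omega
      refine Finset.sum_bij' (fun F _ => split H u F) (fun F _ => merge u v F) ?_ ?_ ?_ ?_ ?_ <;>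
        simp only [Finset.mem_filter, Finset.mem_univ, true_and, and_imp]
      · intro F hF h
        exact ⟨split_mul hF u, (split_idx_lt (mul_eq_of_mul_eq hF).1 hv h).ne⟩
      · intro F hF h
        exact ⟨merge_mul hF hv hG (hlt F hF h),
          merge_idx_eq (mul_eq_of_mul_eq hF).1 hv (hlt F hF h)⟩
      · intro F hF h
        exact merge_split (mul_eq_of_mul_eq hF).1 (mul_eq_of_mul_eq (split_mul hF u)).1 hv h
      · intro F hF h
        exact split_merge (mul_eq_of_mul_eq hF).1
          (mul_eq_of_mul_eq (merge_mul hF hv hG (hlt F hF h))).1 hv (hlt F hF h)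
      · intro F hF h
        have hl := length_split (mul_eq_of_mul_eq hF).1 hv h
        have hle := (split H u F).length_le
        have : n - F.length = n - (split H u F).length + 1 := by omega
        rw [sign, sign, this, pow_succ]
        ring
    · rw [Finset.filter_false_of_mem fun F _ hF => hHG (mul_eq_of_mul_eq hF).2, Finset.sum_empty]

/-! ### Chambers -/

/-- A face all of whose blocks are singletons is preserved by right multiplication. -/
theorem mul_eq_left_of_injective {C : SetComposition n} (hC : Function.Injective C.idx)
    (F : SetComposition n) : C * F = C :=
  mul_eq_left_iff.2 fun _ _ h => congrArg _ (hC h)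

theorem length_of_injective {C : SetComposition n} (hC : Function.Injective C.idx) :
    C.length = n := by
  rw [length_eq_card, Finset.card_image_of_injective _ hC, Finset.card_univ, Fintype.card_fin]

theorem injective_idx_mul (F : SetComposition n) {C : SetComposition n}
    (hC : Function.Injective C.idx) : Function.Injective (F * C).idx :=
  fun _ _ h => hC ((idx_mul_eq F C _ _).1 h).2

theorem injective_idx_reverse {C : SetComposition n}
    (hC : Function.Injective C.idx) : Function.Injective C.reverse.idx :=
  fun _ _ h => hC ((idx_reverse_eq C _ _).1 h)

theorem exists_injective_idx (n : ℕ) : ∃ C : SetComposition n, Function.Injective C.idx := by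
  refine ⟨ofFun fun x => x, fun x y h => Fin.ext ?_⟩
  have h1 := idx_ofFun_lt (fun x : Fin n => (x : ℕ)) x y
  have h2 := idx_ofFun_lt (fun x : Fin n => (x : ℕ)) y x
  omega

/-- If `F'` sends the chamber `F.reverse * (F * C)` to `F * C`, then `F'` refines `F`. -/
theorem mul_eq_right_of_mul_reverse_mul {F F' C : SetComposition n}
    (h : F' * (F.reverse * (F * C)) = F * C) : F * F' = F' := by
  refine mul_eq_right_iff.2 fun x y hxy => ?_
  have h1 := (idx_mul_lt F C x y).2 (Or.inl hxy)
  rw [← h, idx_mul_lt] at h1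
  -- If `F'` tied `x` and `y`, the order would be left to `F.reverse`, which puts `y` first.
  refine h1.resolve_right fun ⟨_, h2⟩ => ?_
  rw [idx_mul_lt, idx_reverse_lt, idx_reverse_eq] at h2
  omega

theorem mul_reverse_self_mul (F D : SetComposition n) : F * (F.reverse * D) = F * D := by
  rw [← mul_assoc, mul_reverse_eq_left_iff.2 (mul_self F)]

end SetComposition

/-! ## The image of `w0` in the face algebra -/

open SetComposition

section faceAlgebra

variable {n : ℕ} (k : Type*) [CommRing k]

/-- The signed sum of all faces. -/
noncomputable def signedFaceSum (n : ℕ) : FaceAlgebra k n :=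
  ∑ F : SetComposition n, MonoidAlgebra.single F (F.sign k)

/-- The boundaries of `gaps n I` are `0`, `n` and one for each element of `I`, and their number is
the length plus one. -/
theorem length_gaps (I : Finset (Fin (n - 1))) : n - (gaps n I).length = Iᶜ.card := by
  -- For `n = 0` the boundaries `0` and `n` coincide, but both sides vanish.
  obtain _ | m := n
  · have : Iᶜ.card ≤ 0 := Finset.card_le_univ _
    omega
  · have h1 : (compositionAsSetEquiv (m + 1)).symm I = (gaps (m + 1) I).toCompositionAsSet :=
      ((compositionEquiv (m + 1)).apply_symm_apply _).symm
    have h2 := (gaps (m + 1) I).card_boundaries_eq_succ_length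
    have h3 : (gaps (m + 1) I).boundaries =
        insert 0 (insert (Fin.last _) (I.image fun j : Fin m => (j.castSucc.succ : Fin (m + 2)))) := by
      change ((gaps (m + 1) I).toCompositionAsSet).boundaries = _
      rw [← h1]
      ext i
      simp only [compositionAsSetEquiv, Equiv.coe_fn_symm_mk, Set.mem_toFinset, Set.mem_ofPred_eq,
        Finset.mem_insert, Finset.mem_image, exists_prop]
      refine or_congr Iff.rfl (or_congr Iff.rfl (exists_congr fun j => and_congr Iff.rfl ?_))
      rw [Fin.ext_iff, eq_comm]
      rfl
    rw [h3, Finset.card_insert_of_notMem, Finset.card_insert_of_notMem,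
      Finset.card_image_of_injective] at h2
    · have h4 := Finset.card_compl I
      have h5 := Finset.card_le_univ I
      simp only [Fintype.card_fin] at h4 h5
      omega
    · intro a b hab
      exact Fin.castSucc_injective _ (Fin.succ_injective _ hab)
    · simp only [Finset.mem_image, not_exists, not_and]
      intro j _ hj
      have := congrArg Fin.val hj
      simp at this
      omega
    · simp only [Finset.mem_insert, Finset.mem_image, not_or, not_exists, not_and]
      exact ⟨(Fin.last_pos).ne, fun j _ => Fin.succ_ne_zero _⟩

namespace DescentAlgebra

/-- The coefficient at `w` is an alternating sum over all supersets of `des w`. It vanishes unless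
`des w` is everything, and only the reversal has all descents. -/
theorem w0_eq_sum : w0 k n = ∑ I : Finset (Fin (n - 1)), (-1 : k) ^ Iᶜ.card • B k I := by
  classical
  ext w
  have h : ∑ I : Finset (Fin (n - 1)), (-1 : k) ^ Iᶜ.card * (if des w ⊆ I then 1 else 0) =
      if des w = Finset.univ then 1 else 0 := by
    simp only [mul_ite, mul_one, mul_zero]
    rw [← Finset.sum_filter]
    have : ∑ I : Finset (Fin (n - 1)) with des w ⊆ I, (-1 : k) ^ Iᶜ.card =
        ∑ K ∈ (des w)ᶜ.powerset, (-1 : k) ^ K.card := by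
      refine Finset.sum_nbij' compl compl ?_ ?_ (fun I _ => compl_compl I)
        (fun I _ => compl_compl I) (fun _ _ => rfl)
      · simp
      · intro K hK
        simpa [Finset.subset_compl_comm] using hK
    have hc := congrArg (Int.cast : ℤ → k)
      (Finset.sum_powerset_neg_one_pow_card (x := (des w)ᶜ))
    push_cast at hc
    rw [this, hc]
    simp [Finset.compl_eq_empty_iff]
  rw [MonoidAlgebra.coeff_sum, Finsupp.finsetSum_apply]
  simp only [MonoidAlgebra.coeff_smul_apply, coeff_B, smul_eq_mul]
  rw [h]
  simp only [des_eq_univ_iff, w0, MonoidAlgebra.coeff_single, Finsupp.single_apply, eq_comm]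

/-- The sign depends only on the type, so the alternating sum of the `faceB k α` regroups into one
over single faces. -/
theorem w0Tilde_eq : w0Tilde k n = signedFaceSum k n := by
  classical
  have h : (⟨w0 k n, w0_mem k⟩ : descentAlgebra k n) =
      ∑ I : Finset (Fin (n - 1)), (-1 : k) ^ Iᶜ.card • basisB k n I := by
    refine Subtype.ext ?_
    rw [AddSubmonoidClass.coe_finsetSum]
    have hb : ∀ I, (basisB k n I : MonoidAlgebra k (Equiv.Perm (Fin n))) = B k I := fun I =>
      congrArg Subtype.val (Module.Basis.span_apply (linearIndependent_B k) I)
    simp only [SetLike.val_smul, hb]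
    exact w0_eq_sum k
  rw [w0Tilde, h, map_sum]
  simp only [map_smul, rho, Module.Basis.constr_basis, ← length_gaps]
  rw [Equiv.sum_comp (gaps n) fun α : Composition n => (-1 : k) ^ (n - α.length) • faceB k α,
    signedFaceSum, ← Finset.sum_fiberwise (s := Finset.univ) (g := SetComposition.type)]
  refine Finset.sum_congr rfl fun α _ => ?_
  rw [faceB, Finset.smul_sum]
  refine Finset.sum_congr rfl fun F hF => ?_
  rw [MonoidAlgebra.smul_single, smul_eq_mul, mul_one, ← (Finset.mem_filter.1 hF).2]
  simp [SetComposition.sign, type, Composition.length, SetComposition.length]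

end DescentAlgebra

open Classical in
theorem signedFaceSum_mul_single (G : SetComposition n) :
    signedFaceSum k n * MonoidAlgebra.single G 1 =
      ∑ H : SetComposition n with G.reverse * H = H, MonoidAlgebra.single H (H.sign k) := by
  simp only [signedFaceSum, Finset.sum_mul, MonoidAlgebra.single_mul_single, mul_one]
  ext H
  have := sum_sign_of_mul_eq k G H
  simp only [MonoidAlgebra.coeff_sum, Finsupp.finsetSum_apply, MonoidAlgebra.coeff_single,
    Finsupp.single_apply, ← Finset.sum_filter, Finset.filter_filter]
  rw [this, Finset.sum_filter]
  rw [Finset.sum_eq_single H]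
  · simp
  · intro F _ hF
    simp [hF]
  · simp

/-- A chamber has no proper refinement, so a single term survives, with sign `1`. -/
theorem signedFaceSum_mul_chamber {C : SetComposition n} (hC : Function.Injective C.idx) :
    signedFaceSum k n * MonoidAlgebra.single C 1 = MonoidAlgebra.single C.reverse 1 := by
  classical
  rw [signedFaceSum_mul_single, Finset.sum_eq_single C.reverse]
  · rw [SetComposition.sign, length_of_injective (injective_idx_reverse hC), Nat.sub_self, pow_zero]
  · intro H hH hne
    rw [Finset.mem_filter, mul_eq_left_of_injective (injective_idx_reverse hC)] at hH
    exact (hne hH.2.symm).elim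
  · intro h
    simp [mul_self] at h

/-- The face algebra acts faithfully on chambers. -/
theorem eq_zero_of_mul_chamber {z : FaceAlgebra k n}
    (h : ∀ C : SetComposition n, Function.Injective C.idx → z * MonoidAlgebra.single C 1 = 0) :
    z = 0 := by
  classical
  obtain ⟨C, hC⟩ := exists_injective_idx n
  suffices ∀ d, ∀ F : SetComposition n, n - F.length = d → z.coeff F = 0 by
    ext F
    exact this _ F rfl
  intro d
  induction d using Nat.strong_induction_on with
  -- Longest faces come first. In the product of `z` with the chamber `F.reverse * (F * C)`, only
  -- refinements of `F` contribute to the coefficient at `F * C`, and the proper ones have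
  -- coefficient zero by induction.
  | _ d ih =>
    intro F hd
    have hz := congrArg (fun x => x.coeff (F * C))
      (h (F.reverse * (F * C)) (injective_idx_mul _ (injective_idx_mul _ hC)))
    simp only [MonoidAlgebra.coeff_zero, Finsupp.coe_zero, Pi.zero_apply] at hz
    have hsum : z = ∑ F' : SetComposition n, MonoidAlgebra.single F' (z.coeff F') := by
      ext G
      simp [MonoidAlgebra.coeff_sum]
    rw [hsum, Finset.sum_mul] at hz
    simp only [MonoidAlgebra.single_mul_single, mul_one, MonoidAlgebra.coeff_sum,
      Finsupp.finsetSum_apply, MonoidAlgebra.coeff_single, Finsupp.single_apply] at hz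
    rw [Finset.sum_eq_single F, if_pos] at hz
    · exact hz
    · rw [mul_reverse_self_mul, mul_mul_self_left]
    · intro F' _ hne
      split_ifs with hF'
      · have hr := mul_eq_right_of_mul_reverse_mul hF'
        have hlt : F.length < F'.length := by
          by_contra hle
          exact hne (eq_of_mul_eq_of_length_le hr (not_lt.1 hle))
        have := F'.length_le
        exact ih _ (by omega) F' rfl
      · rfl
    · simp

/-- On a chamber the left side acts by `C ↦ C.reverse ↦ G * C.reverse ↦ G.reverse * C`, and
faithfulness concludes. -/
theorem signedFaceSum_mul_mul (G : SetComposition n) :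
    signedFaceSum k n * MonoidAlgebra.single G 1 * signedFaceSum k n =
      MonoidAlgebra.single G.reverse 1 := by
  rw [← sub_eq_zero]
  refine eq_zero_of_mul_chamber k fun C hC => ?_
  rw [sub_mul, mul_assoc, signedFaceSum_mul_chamber k hC, mul_assoc,
    MonoidAlgebra.single_mul_single, mul_one,
    signedFaceSum_mul_chamber k (injective_idx_mul G (injective_idx_reverse hC)),
    MonoidAlgebra.single_mul_single, reverse_mul, reverse_reverse, mul_one, sub_self]

/-! ### Characters of the face algebra -/

open Classical in
/-- The character of the face algebra that sends a face `G` to `1` if `F` is contained in `G`,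
and to `0` otherwise. -/
noncomputable def faceCharacter (F : SetComposition n) : FaceAlgebra k n →ₐ[k] k :=
  MonoidAlgebra.lift k k (SetComposition n)
    { toFun := fun G => if F * G = F then 1 else 0
      map_one' := by simp
      map_mul' := fun G H => by
        have : F * (G * H) = F ↔ F * G = F ∧ F * H = F := by
          simp only [mul_eq_left_iff, idx_mul_eq]
          exact ⟨fun h => ⟨fun x y e => (h x y e).1, fun x y e => (h x y e).2⟩,
            fun h x y e => ⟨h.1 x y e, h.2 x y e⟩⟩
        simp only [this, ite_and, ite_mul, one_mul, zero_mul] }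

open Classical in
theorem faceCharacter_single (F G : SetComposition n) (a : k) :
    faceCharacter k F (MonoidAlgebra.single G a) = if F * G = F then a else 0 := by
  simp [faceCharacter, MonoidAlgebra.lift_single]

/-- Multiplying by `F.reverse`, on which the character is `1`, restricts the signed sum to
refinements of `F`; the only one containing `F` is `F`. -/
theorem faceCharacter_signedFaceSum (F : SetComposition n) :
    faceCharacter k F (signedFaceSum k n) = F.sign k := by
  classical
  have h := congrArg (faceCharacter k F) (signedFaceSum_mul_single k F.reverse)
  rw [map_mul, faceCharacter_single, if_pos (mul_reverse_eq_left_iff.2 (mul_self F)), mul_one,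
    map_sum] at h
  rw [h]
  simp only [reverse_reverse, faceCharacter_single]
  rw [Finset.sum_eq_single F, if_pos (mul_self F)]
  · intro H hH hne
    rw [if_neg]
    intro hF
    exact hne ((Finset.mem_filter.1 hH).2.symm.trans hF)
  · intro h
    simp [mul_self] at h

theorem faceCharacter_faceB (α : Composition n) (F : SetComposition n) :
    faceCharacter k F (faceB k α) = (F.knapsack α : k) := by
  classical
  rw [faceB, map_sum, knapsack]
  simp only [faceCharacter_single, containedIn_iff_mul_eq]
  rw [Finset.sum_boole, Finset.filter_filter]
  congr 3
  ext G
  simp [and_comm]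

theorem faceCharacter_w0Tilde_mul_faceB (α : Composition n) (F : SetComposition n) :
    faceCharacter k F (DescentAlgebra.w0Tilde k n * faceB k α) =
      ((F.signedKnapsack α : ℤ) : k) := by
  rw [map_mul, DescentAlgebra.w0Tilde_eq, faceCharacter_signedFaceSum, faceCharacter_faceB,
    signedKnapsack, SetComposition.sign]
  push_cast
  rfl

end faceAlgebra

/-! ## Diagonalizability -/

section eigenspaces

variable {k V : Type*} [Field k] [AddCommGroup V] [Module k V]

/-- `T - c` maps the sum of the other eigenspaces onto itself, so some `w` there satisfies `(T - c)
w = (T - c) v`, and `v - w` is an eigenvector or zero. -/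
theorem mem_eigenspace_sup_of_sub_mem {T : Module.End k V} {c : k} {ι : Type*} {p : ι → Prop}
    {μ : ι → k} (h : ∀ i, p i → μ i ≠ c) {v : V}
    (hv : T v - c • v ∈ ⨆ i, ⨆ _ : p i, T.eigenspace (μ i)) :
    v ∈ T.eigenspace c ⊔ ⨆ i, ⨆ _ : p i, T.eigenspace (μ i) := by
  set W : Submodule k V := ⨆ i, ⨆ _ : p i, T.eigenspace (μ i) with hW
  have hsurj : W ≤ W.map (T - c • (1 : Module.End k V)) := by
    conv_lhs => rw [hW]
    refine iSup₂_le fun i hi w hw => ?_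
    have hmem : (μ i - c)⁻¹ • w ∈ W :=
      W.smul_mem _ ((le_iSup₂ (f := fun i (_ : p i) => T.eigenspace (μ i)) i hi) hw)
    refine ⟨_, hmem, ?_⟩
    have hw' := Module.End.mem_eigenspace_iff.1 hw
    have hne : μ i - c ≠ 0 := sub_ne_zero.2 (h i hi)
    simp only [LinearMap.sub_apply, LinearMap.smul_apply, Module.End.one_apply, map_smul, hw']
    rw [← sub_smul, smul_smul, inv_mul_cancel₀ hne, one_smul]
  obtain ⟨w, hw, hwv⟩ := hsurj hv
  have : v = (v - w) + w := by abel
  rw [this]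
  refine Submodule.add_mem_sup (Module.End.mem_eigenspace_iff.2 ?_) hw
  simp only [LinearMap.sub_apply, LinearMap.smul_apply, Module.End.one_apply] at hwv
  calc T (v - w) = (T v - c • v) - (T w - c • w) + c • (v - w) := by
        rw [map_sub, smul_sub]; abel
    _ = c • (v - w) := by rw [hwv, sub_self, zero_add]

theorem isDiagonalizableOperator_of_iSup_eigenspace {T : Module.End k V}
    (h : ⨆ c, T.eigenspace c = ⊤) : IsDiagonalizableOperator T := by
  obtain ⟨s, hs, hspan, hli⟩ := exists_linearIndependent k {v : V | ∃ c : k, T v = c • v}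
  have htop : ⊤ ≤ Submodule.span k (Set.range ((↑) : s → V)) := by
    rw [Subtype.range_coe, hspan, ← h]
    exact iSup_le fun c v hv => Submodule.subset_span ⟨c, Module.End.mem_eigenspace_iff.1 hv⟩
  refine ⟨s, Module.Basis.mk hli htop, fun i => ?_⟩
  rw [Module.Basis.mk_apply]
  exact hs i.2

theorem eigenspace_sq_le_iSup_eigenspace [CharZero k] {T : Module.End k V} {c : k} (hc : c ≠ 0) :
    (T * T).eigenspace (c ^ 2) ≤ ⨆ c, T.eigenspace c := by
  intro v hv
  rw [Module.End.mem_eigenspace_iff, Module.End.mul_apply] at hv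
  -- Since `T (T v) = c ^ 2 • v`, the vectors `c • v ± T v` lie in the eigenspaces for `±c`.
  have hsplit : v = (2 * c)⁻¹ • (c • v + T v) + (2 * c)⁻¹ • (c • v - T v) := by
    rw [← smul_add, add_add_sub_cancel, ← two_smul k, smul_smul, smul_smul, mul_assoc,
      inv_mul_cancel₀ (mul_ne_zero two_ne_zero hc), one_smul]
  rw [hsplit]
  refine add_mem (Submodule.smul_mem _ _ (Submodule.mem_iSup_of_mem c ?_))
    (Submodule.smul_mem _ _ (Submodule.mem_iSup_of_mem (-c) ?_)) <;>
    rw [Module.End.mem_eigenspace_iff]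
  · rw [map_add, map_smul, hv]
    module
  · rw [map_sub, map_smul, hv]
    module

end eigenspaces

open SetComposition

section faceAlgebra

variable {n : ℕ}

open Classical in
/-- The number of indices `i` in `s` such that `x` is fixed under right multiplication by `y i`. -/
noncomputable def fixCount {ι : Type*} (s : Finset ι) (y : ι → SetComposition n)
    (x : SetComposition n) : ℕ :=
  (s.filter fun i => x * y i = x).card

/-- The product refines `x`, so it keeps every index that fixes `x`, and by idempotence it gains
`i`. -/
theorem fixCount_lt {ι : Type*} {s : Finset ι} {y : ι → SetComposition n} {x : SetComposition n}
    {i : ι} (hi : i ∈ s) (h : x * y i ≠ x) : fixCount s y x < fixCount s y (x * y i) := by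
  classical
  refine Finset.card_lt_card ⟨fun j hj => ?_, fun hsub => ?_⟩
  · rw [Finset.mem_filter, mul_eq_left_iff] at hj ⊢
    exact ⟨hj.1, fun a b hab => hj.2 a b ((idx_mul_eq _ _ _ _).1 hab).1⟩
  · refine h (Finset.mem_filter.1 (hsub (Finset.mem_filter.2 ⟨hi, ?_⟩))).2
    rw [mul_assoc, mul_self]

variable (k : Type*) [Field k]

/-- Right multiplication by a sum of faces is diagonalizable, in a triangular way. -/
theorem single_mem_iSup_eigenspace [CharZero k] {ι : Type*} (s : Finset ι) (y : ι → SetComposition n)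
    (x : SetComposition n) :
    (MonoidAlgebra.single x 1 : FaceAlgebra k n) ∈
      ⨆ z, ⨆ _ : fixCount s y x ≤ fixCount s y z,
        Module.End.eigenspace
          (LinearMap.mulRight k (∑ i ∈ s, MonoidAlgebra.single (y i) 1 : FaceAlgebra k n))
          (fixCount s y z : k) := by
  classical
  set T : Module.End k (FaceAlgebra k n) :=
    LinearMap.mulRight k (∑ i ∈ s, MonoidAlgebra.single (y i) 1 : FaceAlgebra k n) with hT
  suffices ∀ d, ∀ x : SetComposition n, n - x.length = d →
      (MonoidAlgebra.single x 1 : FaceAlgebra k n) ∈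
        ⨆ z, ⨆ _ : fixCount s y x ≤ fixCount s y z, T.eigenspace (fixCount s y z : k) from
    this _ x rfl
  intro d
  induction d using Nat.strong_induction_on with
  | _ d ih =>
    intro x hd
    have hsub : T (MonoidAlgebra.single x 1) - (fixCount s y x : k) • MonoidAlgebra.single x 1 =
        ∑ i ∈ s with ¬ x * y i = x, MonoidAlgebra.single (x * y i) 1 := by
      have h1 : T (MonoidAlgebra.single x 1) = ∑ i ∈ s, MonoidAlgebra.single (x * y i) (1 : k) := by
        simp only [hT, LinearMap.mulRight_apply, Finset.mul_sum, MonoidAlgebra.single_mul_single,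
          mul_one]
      have h2 : ∑ i ∈ s with x * y i = x, MonoidAlgebra.single (x * y i) (1 : k) =
          (fixCount s y x : k) • MonoidAlgebra.single x 1 := by
        rw [Finset.sum_congr rfl (g := fun _ => MonoidAlgebra.single x (1 : k))
          fun i hi => by rw [(Finset.mem_filter.1 hi).2], Finset.sum_const, fixCount,
          Nat.cast_smul_eq_nsmul]
      rw [h1, ← Finset.sum_filter_add_sum_filter_not s (fun i => x * y i = x), h2,
        add_sub_cancel_left]
    -- The off-diagonal terms are longer faces with strictly larger counts, so their eigenvalues
    -- differ from that of `x`. The lower bound on the counts is kept for the study of the kernel.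
    have hmem : T (MonoidAlgebra.single x 1) - (fixCount s y x : k) • MonoidAlgebra.single x 1 ∈
        ⨆ z, ⨆ _ : fixCount s y x < fixCount s y z, T.eigenspace (fixCount s y z : k) := by
      rw [hsub]
      refine Submodule.sum_mem _ fun i hi => ?_
      rw [Finset.mem_filter] at hi
      have hlt := fixCount_lt hi.1 hi.2
      have hl := length_lt_length_mul hi.2
      have hle := (x * y i).length_le
      refine SetLike.le_def.1 ?_ (ih _ (by omega) (x * y i) rfl)
      exact iSup₂_le fun z hz => le_iSup₂_of_le z (hlt.trans_le hz) le_rfl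
    refine SetLike.le_def.1 (sup_le ?_ ?_)
      (mem_eigenspace_sup_of_sub_mem (fun z hz => Nat.cast_injective.ne hz.ne') hmem)
    · exact le_iSup₂_of_le x le_rfl le_rfl
    · exact iSup₂_le fun z hz => le_iSup₂_of_le z hz.le le_rfl

/-! ### The square of the operator -/

/-- The faces `G.reverse * G'` for a pair `(G, G')`. -/
def reverseMul (p : SetComposition n × SetComposition n) : SetComposition n := p.1.reverse * p.2

open Classical in
theorem w0Tilde_mul_faceB_sq (α : Composition n) :
    (DescentAlgebra.w0Tilde k n * faceB k α) * (DescentAlgebra.w0Tilde k n * faceB k α) =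
      ∑ p ∈ (Finset.univ.filter fun F : SetComposition n => F.type = α) ×ˢ
        (Finset.univ.filter fun F : SetComposition n => F.type = α),
        MonoidAlgebra.single (reverseMul p) 1 := by
  have h : DescentAlgebra.w0Tilde k n * faceB k α * DescentAlgebra.w0Tilde k n =
      ∑ F : SetComposition n with F.type = α, MonoidAlgebra.single F.reverse 1 := by
    rw [DescentAlgebra.w0Tilde_eq, faceB, Finset.mul_sum, Finset.sum_mul]
    exact Finset.sum_congr rfl fun F _ => signedFaceSum_mul_mul k F
  rw [← mul_assoc, h, faceB, Finset.sum_mul_sum, Finset.sum_product]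
  simp only [MonoidAlgebra.single_mul_single, mul_one, reverseMul]

-- Containment ignores the order of blocks, so the pairs counted are those whose two members both
-- contain `x`.
open Classical in
theorem fixCount_reverseMul (α : Composition n) (x : SetComposition n) :
    fixCount ((Finset.univ.filter fun F : SetComposition n => F.type = α) ×ˢ
      (Finset.univ.filter fun F : SetComposition n => F.type = α)) reverseMul x =
      x.knapsack α ^ 2 := by
  have h : ∀ p : SetComposition n × SetComposition n,
      x * reverseMul p = x ↔ x * p.1 = x ∧ x * p.2 = x := fun p => by
    simp only [reverseMul, mul_eq_left_iff, idx_mul_eq, idx_reverse_eq]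
    exact ⟨fun h => ⟨fun a b e => (h a b e).1, fun a b e => (h a b e).2⟩,
      fun h a b e => ⟨h.1 a b e, h.2 a b e⟩⟩
  rw [fixCount, sq, knapsack, ← Finset.card_product]
  congr 1
  ext p
  simp only [h, containedIn_iff_mul_eq, Finset.mem_filter, Finset.mem_product, Finset.mem_univ,
    true_and]
  tauto

theorem knapsack_mul_ne_zero (x G : SetComposition n) : (x * G).knapsack G.type ≠ 0 := by
  classical
  rw [knapsack]
  refine (Finset.card_pos.2 ⟨G, Finset.mem_filter.2 ⟨Finset.mem_univ _, ?_, rfl⟩⟩).ne'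
  rw [containedIn_iff_mul_eq, mul_assoc, mul_self]

theorem faceAlgebra_eq_sum_smul (v : FaceAlgebra k n) :
    v = ∑ x : SetComposition n, v.coeff x • MonoidAlgebra.single x 1 := by
  ext G
  simp [MonoidAlgebra.coeff_sum]

/-- A face `x * G` is contained in `G`, so its knapsack number for the type of `G` is positive. This
bounds the range of the operator. -/
theorem mul_faceB_mem_span (α : Composition n) (v : FaceAlgebra k n) :
    v * faceB k α ∈ Submodule.span k
      {u | ∃ x : SetComposition n, x.knapsack α ≠ 0 ∧ u = MonoidAlgebra.single x 1} := by
  rw [faceAlgebra_eq_sum_smul k v, Finset.sum_mul]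
  refine Submodule.sum_mem _ fun x _ => ?_
  rw [smul_mul_assoc, faceB, Finset.mul_sum]
  refine Submodule.smul_mem _ _ (Submodule.sum_mem _ fun G hG => Submodule.subset_span ?_)
  refine ⟨x * G, ?_, by rw [MonoidAlgebra.single_mul_single, mul_one]⟩
  rw [← (Finset.mem_filter.1 hG).2]
  exact knapsack_mul_ne_zero x G

theorem iSup_eigenspace_rightMulW0B [CharZero k] (α : Composition n) :
    ⨆ c, (rightMulW0B k α).eigenspace c = ⊤ := by
  classical
  set R := rightMulW0B k α with hR
  have hsq : (R * R : Module.End k (FaceAlgebra k n)) = LinearMap.mulRight k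
      (∑ p ∈ (Finset.univ.filter fun F : SetComposition n => F.type = α) ×ˢ
        (Finset.univ.filter fun F : SetComposition n => F.type = α),
        MonoidAlgebra.single (reverseMul p) 1) := by
    refine LinearMap.ext fun v => ?_
    rw [← w0Tilde_mul_faceB_sq, Module.End.mul_apply, hR, rightMulW0B_apply, rightMulW0B_apply,
      LinearMap.mulRight_apply, mul_assoc]
  have hmem : ∀ x : SetComposition n, (MonoidAlgebra.single x 1 : FaceAlgebra k n) ∈
      ⨆ z : SetComposition n, ⨆ _ : x.knapsack α ^ 2 ≤ z.knapsack α ^ 2,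
        (R * R).eigenspace ((z.knapsack α ^ 2 : ℕ) : k) := by
    intro x
    have := single_mem_iSup_eigenspace k
      ((Finset.univ.filter fun F : SetComposition n => F.type = α) ×ˢ
        (Finset.univ.filter fun F : SetComposition n => F.type = α)) reverseMul x
    simpa only [← hsq, fixCount_reverseMul] using this
  -- The eigenvalue `0` has no splitting into `±c`. Instead, `R v` lies both in the kernel of `R *
  -- R` and in the sum of its eigenspaces for nonzero eigenvalues, which are independent.
  have hker : ∀ v, R (R v) = 0 → R v = 0 := by
    intro v hv
    have hspan : R v ∈ ⨆ c, ⨆ _ : c ≠ 0, (R * R).eigenspace c := by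
      have h1 : R v ∈ Submodule.span k
          {u | ∃ x : SetComposition n, x.knapsack α ≠ 0 ∧ u = MonoidAlgebra.single x 1} := by
        rw [hR, rightMulW0B_apply, ← mul_assoc]
        exact mul_faceB_mem_span k α _
      refine Submodule.span_le.2 ?_ h1
      rintro _ ⟨x, hx, rfl⟩
      -- The eigenvalues needed for `x` are at least `x.knapsack α ^ 2`, hence nonzero.
      refine SetLike.le_def.1 (iSup₂_le fun z hz => ?_) (hmem x)
      refine le_iSup₂_of_le ((z.knapsack α ^ 2 : ℕ) : k) ?_ le_rfl
      rw [Nat.cast_ne_zero]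
      exact ((pow_pos (Nat.pos_of_ne_zero hx) 2).trans_le hz).ne'
    have h0 : R v ∈ (R * R).eigenspace 0 := by
      rw [Module.End.mem_eigenspace_iff, zero_smul, Module.End.mul_apply, hv, map_zero]
    exact Submodule.disjoint_def.1 ((R * R).eigenspaces_iSupIndep 0) _ h0 hspan
  rw [eq_top_iff]
  intro v _
  rw [faceAlgebra_eq_sum_smul k v]
  refine Submodule.sum_mem _ fun x _ => Submodule.smul_mem _ _ ?_
  refine SetLike.le_def.1 (iSup₂_le fun z _ => ?_) (hmem x)
  by_cases hz : z.knapsack α = 0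
  · intro u hu
    refine Submodule.mem_iSup_of_mem 0 ?_
    rw [Module.End.mem_eigenspace_iff, zero_smul]
    rw [hz, Module.End.mem_eigenspace_iff, Module.End.mul_apply] at hu
    exact hker u (by simpa using hu)
  · rw [Nat.cast_pow]
    exact eigenspace_sq_le_iSup_eigenspace (Nat.cast_ne_zero.2 hz)

end faceAlgebra

/-! ## The characteristic polynomial -/

/-- The weight `d` may have ties; an arbitrary enumeration breaks them and gives a linear order for
which `M` is upper triangular. -/
theorem Matrix.charpoly_of_triangular {ι R : Type*} [Fintype ι] [DecidableEq ι] [CommRing R]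
    {M : Matrix ι ι R} (d : ι → ℕ) (h : ∀ i j, i ≠ j → d j ≤ d i → M i j = 0) :
    M.charpoly = ∏ i, (Polynomial.X - Polynomial.C (M i i)) := by
  have e := Fintype.equivFin ι
  let key : ι → ℕ ×ₗ Fin (Fintype.card ι) := fun i => toLex (d i, e i)
  have hkey : Function.Injective key := fun i j hij =>
    e.injective (congrArg (fun p => (ofLex p).2) hij)
  have hblock : M.BlockTriangular key := by
    intro i j hij
    refine h i j (fun he => hij.ne (congrArg key he.symm)) ?_
    rcases Prod.Lex.toLex_lt_toLex.1 hij with h' | h'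
    · exact h'.le
    · exact h'.1.le
  let _ : LinearOrder ι := LinearOrder.lift' key hkey
  convert Matrix.charpoly_of_isUpperTriangular M fun i j hij => hblock hij

section faceAlgebra

open SetComposition

variable {n : ℕ} (k : Type*) [Field k]

/-- The basis of the face algebra that consists of the faces. -/
noncomputable def faceBasis (n : ℕ) : Module.Basis (SetComposition n) k (FaceAlgebra k n) :=
  Module.Basis.ofRepr (MonoidAlgebra.coeffLinearEquiv k)

theorem faceBasis_apply (F : SetComposition n) : faceBasis k n F = MonoidAlgebra.single F 1 := rfl

theorem faceBasis_repr (v : FaceAlgebra k n) (F : SetComposition n) :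
    (faceBasis k n).repr v F = v.coeff F := rfl

open Classical in
theorem coeff_single_mul (b : FaceAlgebra k n) (F H : SetComposition n) :
    (MonoidAlgebra.single F 1 * b).coeff H = ∑ G with F * G = H, b.coeff G := by
  conv_lhs => rw [faceAlgebra_eq_sum_smul k b, Finset.mul_sum]
  simp only [mul_smul_comm, MonoidAlgebra.single_mul_single, mul_one, MonoidAlgebra.coeff_sum,
    Finsupp.finsetSum_apply, MonoidAlgebra.coeff_smul_apply, MonoidAlgebra.coeff_single,
    Finsupp.single_apply, smul_eq_mul, mul_ite, mul_zero]
  rw [Finset.sum_filter]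

/-- The faces `G` that return `F` to itself are exactly those on which the character of `F` equals
`1`. -/
theorem coeff_single_mul_self (b : FaceAlgebra k n) (F : SetComposition n) :
    (MonoidAlgebra.single F 1 * b).coeff F = faceCharacter k F b := by
  classical
  rw [coeff_single_mul]
  conv_rhs => rw [faceAlgebra_eq_sum_smul k b]
  simp [faceCharacter_single, Finset.sum_filter]

/-- Right multiplication by an element of the face algebra is triangular. -/
theorem charpoly_mulRight (b : FaceAlgebra k n) :
    (LinearMap.mulRight k b : Module.End k (FaceAlgebra k n)).charpoly =
      ∏ F : SetComposition n, (Polynomial.X - Polynomial.C (faceCharacter k F b)) := by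
  classical
  rw [← LinearMap.charpoly_toMatrix _ (faceBasis k n),
    -- Right multiplication fixes a face or lengthens it, so `n - length` strictly drops off the
    -- diagonal.
    Matrix.charpoly_of_triangular (fun F : SetComposition n => n - F.length)]
  · refine Finset.prod_congr rfl fun F _ => ?_
    rw [LinearMap.toMatrix_apply, faceBasis_repr, faceBasis_apply, LinearMap.mulRight_apply,
      coeff_single_mul_self]
  · intro H F hne hle
    rw [LinearMap.toMatrix_apply, faceBasis_repr, faceBasis_apply, LinearMap.mulRight_apply,
      coeff_single_mul]
    refine Finset.sum_eq_zero fun G hG => ?_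
    exfalso
    have hG' := (Finset.mem_filter.1 hG).2
    have h2 := H.length_le
    have h5 := length_lt_length_mul fun h : F * G = F => hne (hG'.symm.trans h)
    rw [hG'] at h5
    omega

theorem charpoly_rightMulW0B (α : Composition n) :
    (rightMulW0B k α).charpoly = ∏ F : SetComposition n,
      (Polynomial.X - Polynomial.C ((F.signedKnapsack α : ℤ) : k)) := by
  simp only [rightMulW0B, charpoly_mulRight, faceCharacter_w0Tilde_mul_faceB]

end faceAlgebra

theorem mainTheorem4 {k : Type*} [Field k] [CharZero k] {n : ℕ} (α : Composition n) :
    IsDiagonalizableOperator (rightMulW0B k α) ∧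
    (∀ c : k, (rightMulW0B k α).HasEigenvalue c ↔
      ∃ F : SetComposition n, ((F.signedKnapsack α : ℤ) : k) = c) ∧
    (∀ c : k, (rightMulW0B k α).charpoly.rootMultiplicity c =
      Nat.card {F : SetComposition n // ((F.signedKnapsack α : ℤ) : k) = c}) := by
  classical
  have : Module.Finite k (FaceAlgebra k n) := Module.Finite.of_basis (faceBasis k n)
  have : Module.Free k (FaceAlgebra k n) := Module.Free.of_basis (faceBasis k n)
  refine ⟨isDiagonalizableOperator_of_iSup_eigenspace (iSup_eigenspace_rightMulW0B k α),
    fun c => ?_, fun c => ?_⟩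
  · rw [Module.End.hasEigenvalue_iff_isRoot_charpoly, charpoly_rightMulW0B, Polynomial.IsRoot.def,
      Polynomial.eval_prod, Finset.prod_eq_zero_iff]
    simp only [Finset.mem_univ, true_and, Polynomial.eval_sub, Polynomial.eval_X,
      Polynomial.eval_C, sub_eq_zero]
    exact exists_congr fun F => eq_comm
  · have h : (∏ F : SetComposition n,
        (Polynomial.X - Polynomial.C ((F.signedKnapsack α : ℤ) : k))).roots =
        Finset.univ.val.map fun F : SetComposition n => ((F.signedKnapsack α : ℤ) : k) :=
      (congrArg Polynomial.roots (by rw [Multiset.map_map]; rfl)).trans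
        (Polynomial.roots_multiset_prod_X_sub_C _)
    rw [charpoly_rightMulW0B, ← Polynomial.count_roots, h, Multiset.count_map,
      Nat.card_eq_fintype_card, Fintype.card_subtype]
    simp only [eq_comm (a := c)]
    rfl
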